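/- Let $d\ge 1$, $\sigma,\alpha,\nu>0$ and let $M$ be a real $d\times d$ matrix with $\det M=1$. For $t>0$ put \[ K(t)=\frac{\sigma^2(\alpha t)^\nu}{\Gamma(\nu)2^{\nu-1}}\,\mathcal K_\nu(\alpha t),\qquad K(0)=\sigma^2, \] where $\mathcal K_\nu$ is the modified Bessel function of the second kind of order $\nu$. A mean-zero geometric anisotropic Matérn Gaussian random field with parameters $(\sigma,\alpha,\nu,M)$ on a set $D\subset\mathbb R^d$ is a Gaussian process $(Y(t))_{t\in D}$ with $\mathsf E\,Y(t)=0$ and $\operatorname{cov}(Y(s),Y(t))=K(|Ms-Mt|)$ for all $s,t\in D$, where $|\cdot|$ is the Euclidean norm. Let $G_\nu(0)=0$ and, for $t>0$, \[ G_\nu(t)=\begin{cases}\dfrac{(-1)^{\nu+1}}{2^{2\nu-1}\Gamma(\nu)\Gamma(\nu+1)}\,t^{2\nu}\log t,&\nu\in\mathbb Z,\\[2ex] \dfrac{-\pi}{2^{2\nu}\sin(\nu\pi)\Gamma(\nu)\Gamma(\nu+1)}\,t^{2\nu},&\nu\notin\mathbb Z.\end{cases} \] Let $\Omega\subset\mathbb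 R^d$ be a nonempty, bounded, open set, let $\Omega_n=\Omega\cap(\mathbb Z^d/n)$, let $h\in\mathbb R^d$ be nonzero, and let $m$ be an integer with $m>\nu$. Let $Y$ be a field as above on a set $D$ such that, for all sufficiently large $n$, the points $j+\frac kn h$ with $j\in\Omega_n$ and $0\le k\le m$ lie in $D$ (for example $D=\mathbb R^d$, or any open $D$ containing the closure of $\Omega$). Put $\Delta_uY(t)=Y(t+u)-Y(t)$, $\Delta_u^m=\Delta_u\Delta_u^{m-1}$, and \[ Q_n^m=\frac1{\#\Omega_n}\sum_{j\in\Omega_n}n^{2\nu}\bigl(\Delta_{h/n}^mY(j)\bigr)^2,\qquad a_\nu^m=\sigma^2\alpha^{2\nu}|Mh|^{2\nu}\sum_{i,j=0}^m(-1)^{i+j}\binom mi\binom mj G_\nu(|i-j|). \] Then $Q_n^m\to a_\nu^m$ with probability one as $n\to\infty$. Moreover, there is a constant $c>0$, not depending on $n$, such that for all sufficiently large $n$ the variable $Q_n^m$ is square integrable and \[ \operatorname{var}Q_n^m\le\begin{cases}c\,n^{4(\nu-m)},&\text{if }4(\nu-m)>-d;\\ c\,n^{-d}\log n,&\text{if }4(\nu-m)=-d;\\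 c\,n^{-d},&\text{if }4(\nu-m)<-d.\end{cases} \] -/

import Mathlib

open MeasureTheory ProbabilityTheory Filter Topology

noncomputable section

namespace Matern

/-- The modified Bessel function of the second kind of order `ν`, for arguments `x > 0`:
`K_ν(x) = ∫_0^∞ exp (-x cosh t) cosh (ν t) dt`. -/
def besselK (ν x : ℝ) : ℝ :=
  ∫ t in Set.Ioi (0 : ℝ), Real.exp (-x * Real.cosh t) * Real.cosh (ν * t)

/-- The isotropic Matérn autocovariance function with variance `σ ^ 2`, inverse range `α` and
smoothness `ν`, as a function of the distance `t ≥ 0`. -/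
def covFun (σ α ν t : ℝ) : ℝ :=
  if t = 0 then σ ^ 2
  else σ ^ 2 * (α * t) ^ ν / (Real.Gamma ν * (2 : ℝ) ^ (ν - 1)) * besselK ν (α * t)

/-- The principal irregular term `G_ν` of the Matérn autocovariance, as a function of `t ≥ 0`.
When `ν` is an integer, `⌊ν⌋ = ν`. -/
def irregularTerm (ν t : ℝ) : ℝ :=
  open scoped Classical in
  if t = 0 then 0
  else if ∃ k : ℤ, ν = k then
    (-1 : ℝ) ^ (⌊ν⌋ + 1) / ((2 : ℝ) ^ (2 * ν - 1) * Real.Gamma ν * Real.Gamma (ν + 1))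
      * (t ^ (2 * ν) * Real.log t)
  else
    -Real.pi / ((2 : ℝ) ^ (2 * ν) * Real.sin (ν * Real.pi) * Real.Gamma ν * Real.Gamma (ν + 1))
      * t ^ (2 * ν)

/-- `Y`, restricted to the index set `D ⊆ ℝ^d`, is a mean-zero geometric anisotropic Matérn
Gaussian random field with parameters `(σ, α, ν, M)`. The values of `Y` off `D` are irrelevant. -/
structure IsField {d : ℕ} {S : Type*} [MeasurableSpace S] (P : Measure S) (σ α ν : ℝ)
    (M : Matrix (Fin d) (Fin d) ℝ) (D : Set (EuclideanSpace ℝ (Fin d)))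
    (Y : EuclideanSpace ℝ (Fin d) → S → ℝ) : Prop where
  sigma_pos : 0 < σ
  alpha_pos : 0 < α
  nu_pos : 0 < ν
  det_eq_one : M.det = 1
  gaussian : IsGaussianProcess (fun t : D => Y t) P
  mean_zero : ∀ t ∈ D, ∫ ω, Y t ω ∂P = 0
  cov_eq : ∀ s ∈ D, ∀ t ∈ D,
    cov[Y s, Y t; P] = covFun σ α ν ‖Matrix.toEuclideanLin M s - Matrix.toEuclideanLin M t‖

/-- The grid `Ω_n = Ω ∩ (ℤ^d / n)`. -/
def grid {d : ℕ} (Ω : Set (EuclideanSpace ℝ (Fin d))) (n : ℕ) :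
    Set (EuclideanSpace ℝ (Fin d)) :=
  {t | t ∈ Ω ∧ ∃ k : Fin d → ℤ, ∀ i, t i = (k i : ℝ) / n}

/-- The normalized quadratic variation
`Q_n^m = (#Ω_n)⁻¹ ∑_{j ∈ Ω_n} n ^ (2ν) (Δ_{h/n}^m Y(j)) ^ 2`. -/
def quadVar {d : ℕ} {S : Type*} (ν : ℝ) (h : EuclideanSpace ℝ (Fin d)) (m : ℕ)
    (Ω : Set (EuclideanSpace ℝ (Fin d))) (Y : EuclideanSpace ℝ (Fin d) → S → ℝ)
    (n : ℕ) (ω : S) : ℝ :=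
  1 / ((grid Ω n).ncard : ℝ) *
    ∑ᶠ j ∈ grid Ω n,
      (n : ℝ) ^ (2 * ν) * ((fwdDiff ((1 / (n : ℝ)) • h))^[m] (fun t => Y t ω) j) ^ 2

/-- The limit
`a_ν^m = σ² α^{2ν} |M h|^{2ν} ∑_{i,j=0}^m (-1)^{i+j} (m choose i) (m choose j) G_ν(|i-j|)`. -/
def limitCoeff {d : ℕ} (σ α ν : ℝ) (M : Matrix (Fin d) (Fin d) ℝ)
    (h : EuclideanSpace ℝ (Fin d)) (m : ℕ) : ℝ :=
  σ ^ 2 * α ^ (2 * ν) * ‖Matrix.toEuclideanLin M h‖ ^ (2 * ν) *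
    ∑ i ∈ Finset.range (m + 1), ∑ j ∈ Finset.range (m + 1),
      (-1 : ℝ) ^ (i + j) * (m.choose i : ℝ) * (m.choose j : ℝ)
        * irregularTerm ν |(i : ℝ) - (j : ℝ)|

end Matern

end

noncomputable section

namespace Matern

/-! The Matérn covariance is a scale mixture of Gaussians: `K(t)` is a constant times the integral
of `u^(-ν-1) exp(-α²/(4u)) exp(-t² u)` over `u > 0` (`covFun_eq_integral`). Covariances of `m`-th
differences thus become integrals of differenced Gaussians, and both inputs about the field are read
off from them.

At lag zero the differenced Gaussian is an exponential sum whose moments of order below `m` vanish,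
so it is `O(u^m)` at `0` and integrable against `u^(-ν-1)` because `ν < m`. Rescaling `u` by
`(|Mh|/n)²` and dominated convergence remove the factor `exp(-α²/(4u))`; repeated integration by
parts evaluates the limit through the Gamma function, or through Frullani's integral when `ν` is an
integer, which produces `G_ν` and its logarithm. This is the convergence of `E Q_n`
(`tendsto_covDiff_zero`).

At large lag, the double `m`-th difference is a single `2m`-th difference along a line, bounded by a
`2m`-th derivative of a Gaussian. Hence normalised increments at grid points `k/n` and `l/n` have
covariance `O(|k-l|^(2(ν-m)))` away from the diagonal (`exists_abs_covDiff_le`).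

Finally `Q_n` is a Gaussian quadratic form. Diagonalising the covariance matrix makes it a sum of
squares of independent Gaussians, so its variance is a constant times the sum of squared
covariances, and it concentrates exponentially at the scale of the square root of that sum. Summing
over lattice shells bounds the sum by `n^(-d) (1 + ∑_{r<Rn} (r+1)^(d-1+4(ν-m)))`. This yields the
three variance regimes; concentration with Borel–Cantelli yields almost sure convergence, even where
the variance bound is not summable. -/

/-! ### The Matérn covariance as a Gaussian scale mixture -/

/-- The unnormalised inverse Gamma density `u ^ (-ν - 1) * exp (-a / u)`, the mixing density of the
Matérn covariance as a scale mixture of Gaussians. -/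
def mixDensity (ν a u : ℝ) : ℝ := u ^ (-ν - 1) * Real.exp (-(a / u))

lemma mixDensity_nonneg (ν a : ℝ) {u : ℝ} (hu : 0 < u) : 0 ≤ mixDensity ν a u := by
  unfold mixDensity; positivity

lemma mixDensity_le_rpow (ν : ℝ) {a u : ℝ} (ha : 0 ≤ a) (hu : 0 < u) :
    mixDensity ν a u ≤ u ^ (-ν - 1) := by
  unfold mixDensity
  have : Real.exp (-(a / u)) ≤ 1 := Real.exp_le_one_iff.2 (by have := div_nonneg ha hu.le; linarith)
  exact mul_le_of_le_one_right (by positivity) this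

lemma measurable_mixDensity (ν a : ℝ) : Measurable (mixDensity ν a) := by
  unfold mixDensity; fun_prop

/-- Inversion turns the inverse Gamma density into a Gamma density; the right-hand side is shaped
for the change of variables `u ↦ u ^ (-1)`. -/
lemma mixDensity_eq_comp_inv (ν a : ℝ) {u : ℝ} (hu : 0 < u) :
    mixDensity ν a u =
      (|(-1 : ℝ)| * u ^ ((-1 : ℝ) - 1)) • ((u ^ (-1 : ℝ)) ^ (ν - 1) *
        Real.exp (-(a * u ^ (-1 : ℝ)))) := by
  rw [mixDensity, abs_neg, abs_one, one_mul, smul_eq_mul, ← mul_assoc, ← Real.rpow_mul hu.le,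
    ← Real.rpow_add hu, Real.rpow_neg_one, div_eq_mul_inv]
  congr 2
  ring

lemma integrableOn_mixDensity {ν a : ℝ} (hν : 0 < ν) (ha : 0 < a) :
    IntegrableOn (mixDensity ν a) (Set.Ioi 0) := by
  have h1 : IntegrableOn (fun v : ℝ => v ^ (ν - 1) * Real.exp (-(a * v))) (Set.Ioi 0) := by
    have := integrableOn_rpow_mul_exp_neg_mul_rpow (p := 1) (s := ν - 1) (b := a) (by linarith)
      one_pos ha
    simpa [neg_mul] using this
  have h2 := (integrableOn_Ioi_comp_rpow_iff _ (p := -1) (by norm_num)).2 h1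
  exact h2.congr_fun (fun u hu => (mixDensity_eq_comp_inv ν a hu).symm) measurableSet_Ioi

lemma integral_mixDensity {ν a : ℝ} (hν : 0 < ν) (ha : 0 < a) :
    ∫ u in Set.Ioi 0, mixDensity ν a u = Real.Gamma ν / a ^ ν := by
  rw [setIntegral_congr_fun measurableSet_Ioi (fun u hu => mixDensity_eq_comp_inv ν a hu),
    integral_comp_rpow_Ioi (fun v => v ^ (ν - 1) * Real.exp (-(a * v))) (by norm_num),
    Real.integral_rpow_mul_exp_neg_mul_Ioi hν ha, one_div, Real.inv_rpow ha.le]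
  field_simp

lemma integrableOn_mixDensity_mul_exp {ν a : ℝ} (hν : 0 < ν) (ha : 0 < a) {l : ℝ} (hl : 0 ≤ l) :
    IntegrableOn (fun u => mixDensity ν a u * Real.exp (-(l * u))) (Set.Ioi 0) := by
  refine (integrableOn_mixDensity hν ha).mono'
    (by have := measurable_mixDensity ν a; fun_prop) ?_
  refine (ae_restrict_mem measurableSet_Ioi).mono fun u (hu : 0 < u) => ?_
  have h1 := mixDensity_nonneg ν a hu
  rw [Real.norm_of_nonneg (by positivity)]
  exact mul_le_of_le_one_right h1 (Real.exp_le_one_iff.2 (by have := mul_nonneg hl hu.le; linarith))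

/-- The substitution `u = (α / 2t) e^s` balances the two exponents: `α²/(4u) + t² u` becomes `αt
cosh s`. -/
lemma mixDensity_comp_exp {ν α t : ℝ} (hα : 0 < α) (ht : 0 < t) (s : ℝ) :
    |α / (2 * t) * Real.exp s| • (mixDensity ν (α ^ 2 / 4) (α / (2 * t) * Real.exp s) *
      Real.exp (-(t ^ 2 * (α / (2 * t) * Real.exp s)))) =
    (α / (2 * t)) ^ (-ν) * (Real.exp (-(α * t) * Real.cosh s) * Real.exp (-ν * s)) := by
  have hb : 0 < α / (2 * t) := by positivity
  have hbs : 0 < α / (2 * t) * Real.exp s := by positivity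
  have e1 : α / (2 * t) * Real.exp s * (α / (2 * t) * Real.exp s) ^ (-ν - 1) =
      (α / (2 * t)) ^ (-ν) * Real.exp (-ν * s) := by
    rw [Real.rpow_sub_one hbs.ne', mul_div_cancel₀ _ hbs.ne', Real.mul_rpow hb.le
      (Real.exp_pos s).le, ← Real.exp_mul]
    ring_nf
  have e2 : Real.exp (-(α ^ 2 / 4 / (α / (2 * t) * Real.exp s))) *
      Real.exp (-(t ^ 2 * (α / (2 * t) * Real.exp s))) = Real.exp (-(α * t) * Real.cosh s) := by
    rw [← Real.exp_add, Real.cosh_eq, Real.exp_neg s]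
    congr 1
    have := Real.exp_pos s
    field_simp
    ring
  rw [abs_of_pos hbs, smul_eq_mul, mixDensity, mul_assoc (_ ^ _), e2, ← mul_assoc, e1]
  ring

lemma besselK_eq_integral_mixDensity {ν α t : ℝ} (hν : 0 < ν) (hα : 0 < α) (ht : 0 < t) :
    ∫ u in Set.Ioi 0, mixDensity ν (α ^ 2 / 4) u * Real.exp (-(t ^ 2 * u)) =
      (α / (2 * t)) ^ (-ν) * (2 * besselK ν (α * t)) := by
  have hb : 0 < α / (2 * t) := by positivity
  set F : ℝ → ℝ := fun s => α / (2 * t) * Real.exp s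
  set g : ℝ → ℝ := fun u => mixDensity ν (α ^ 2 / 4) u * Real.exp (-(t ^ 2 * u)) with hg
  have himg : F '' Set.univ = Set.Ioi 0 := by
    ext u
    simp only [Set.image_univ, Set.mem_range, Set.mem_Ioi]
    constructor
    · rintro ⟨s, rfl⟩; positivity
    · intro hu
      refine ⟨Real.log (u / (α / (2 * t))), ?_⟩
      simp only [F]
      rw [Real.exp_log (by positivity), mul_div_cancel₀ _ hb.ne']
  have hder : ∀ s ∈ Set.univ, HasDerivWithinAt F (F s) Set.univ s := fun s _ =>
    ((Real.hasDerivAt_exp s).const_mul _).hasDerivWithinAt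
  have hinj : Set.InjOn F Set.univ := fun x _ y _ h =>
    Real.exp_injective (mul_left_cancel₀ hb.ne' h)
  have hint : Integrable (fun s => Real.exp (-(α * t) * Real.cosh s) * Real.exp (-ν * s)) := by
    have h1 : IntegrableOn g (Set.Ioi 0) :=
      integrableOn_mixDensity_mul_exp hν (by positivity) (by positivity)
    rw [← himg, integrableOn_image_iff_integrableOn_abs_deriv_smul MeasurableSet.univ hder hinj,
      integrableOn_univ] at h1
    simp only [F, g, mixDensity_comp_exp hα ht] at h1
    exact (integrable_const_mul_iff (isUnit_iff_ne_zero.2 (by positivity)) _).1 h1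
  have h2 := integral_image_eq_integral_abs_deriv_smul MeasurableSet.univ hder hinj g
  rw [himg, setIntegral_univ] at h2
  simp only [F, g, mixDensity_comp_exp hα ht] at h2
  rw [h2, integral_const_mul]
  congr 1
  -- The weight `exp (-αt cosh s)` is even, so `exp (-νs)` may be replaced by `cosh (νs)`, and the
  -- integral over the line is twice the one defining `besselK`.
  have hneg : ∫ s, Real.exp (-(α * t) * Real.cosh s) * Real.exp (-ν * s) =
      ∫ s, Real.exp (-(α * t) * Real.cosh s) * Real.exp (ν * s) := by
    rw [← integral_neg_eq_self]
    simp
  have hint' : Integrable (fun s => Real.exp (-(α * t) * Real.cosh s) * Real.exp (ν * s)) := by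
    simpa using hint.comp_neg
  have hsum : ∫ s, Real.exp (-(α * t) * Real.cosh s) * Real.cosh (ν * s) =
      ∫ s, Real.exp (-(α * t) * Real.cosh s) * Real.exp (-ν * s) := by
    have : ∀ s, Real.exp (-(α * t) * Real.cosh s) * Real.cosh (ν * s) =
      (1 / 2) * (Real.exp (-(α * t) * Real.cosh s) * Real.exp (-ν * s) +
        Real.exp (-(α * t) * Real.cosh s) * Real.exp (ν * s)) := fun s => by
      rw [Real.cosh_eq (ν * s)]; ring_nf
    simp_rw [this]
    rw [integral_const_mul, integral_add hint hint', ← hneg]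
    ring
  rw [← hsum, besselK, ← integral_comp_abs (f := fun s => Real.exp (-(α * t) * Real.cosh s) *
    Real.cosh (ν * s))]
  congr 1
  ext s
  rcases abs_cases s with ⟨h, _⟩ | ⟨h, _⟩ <;> simp [h]

theorem covFun_eq_integral {σ α ν t : ℝ} (hα : 0 < α) (hν : 0 < ν) (ht : 0 ≤ t) :
    covFun σ α ν t = σ ^ 2 * (α ^ 2 / 4) ^ ν / Real.Gamma ν *
      ∫ u in Set.Ioi 0, mixDensity ν (α ^ 2 / 4) u * Real.exp (-(t ^ 2 * u)) := by
  have hΓ := Real.Gamma_pos_of_pos hν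
  rcases ht.eq_or_lt with rfl | ht
  · have : (0 : ℝ) < (α ^ 2 / 4) ^ ν := by positivity
    simp [covFun, integral_mixDensity hν (show 0 < α ^ 2 / 4 by positivity)]
    field_simp
  · rw [besselK_eq_integral_mixDensity hν hα ht, covFun, if_neg ht.ne']
    have e : (α ^ 2 / 4) ^ ν * (α / (2 * t)) ^ (-ν) = (α * t) ^ ν / 2 ^ ν := by
      rw [Real.rpow_neg (by positivity), ← Real.inv_rpow (by positivity),
        ← Real.mul_rpow (by positivity) (by positivity), ← Real.div_rpow (by positivity)
        (by positivity)]
      congr 1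
      field_simp
      norm_num
    have e3 : (2 : ℝ) ^ (ν - 1) = 2 ^ ν / 2 := Real.rpow_sub_one (by norm_num) ν
    calc _ = σ ^ 2 / Real.Gamma ν * ((α * t) ^ ν / 2 ^ ν) * (2 * besselK ν (α * t)) := by
          rw [e3]; field_simp
      _ = _ := by rw [← e]; ring

/-! ### Exponential sums with vanishing moments and regularised Gamma integrals -/

section ExpSum

variable {ι : Type*}

/-- The exponential sum `∑ w_i exp (-λ_i u)`. -/
def expSum (s : Finset ι) (w l : ι → ℝ) (u : ℝ) : ℝ := ∑ i ∈ s, w i * Real.exp (-(l i * u))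

lemma hasDerivAt_expSum (s : Finset ι) (w l : ι → ℝ) (u : ℝ) :
    HasDerivAt (expSum s w l) (-expSum s (fun i => w i * l i) l u) u := by
  have h : HasDerivAt (expSum s w l)
      (∑ i ∈ s, w i * (Real.exp (-(l i * u)) * (-(l i * 1)))) u := by
    unfold expSum
    refine HasDerivAt.fun_sum fun i _ => ?_
    exact ((((hasDerivAt_id u).const_mul (l i)).neg).exp).const_mul (w i)
  convert h using 1
  rw [expSum, ← Finset.sum_neg_distrib]
  exact Finset.sum_congr rfl fun i _ => by ring

lemma continuous_expSum (s : Finset ι) (w l : ι → ℝ) : Continuous (expSum s w l) := by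
  unfold expSum; fun_prop

lemma abs_expSum_le (s : Finset ι) (w l : ι → ℝ) (hl : ∀ i ∈ s, 0 ≤ l i) {u : ℝ} (hu : 0 ≤ u) :
    |expSum s w l u| ≤ ∑ i ∈ s, |w i| := by
  refine (Finset.abs_sum_le_sum_abs _ _).trans (Finset.sum_le_sum fun i hi => ?_)
  rw [abs_mul, abs_of_pos (Real.exp_pos _)]
  exact mul_le_of_le_one_right (abs_nonneg _)
    (Real.exp_le_one_iff.2 (by have := mul_nonneg (hl i hi) hu; linarith))

/-- Differentiating replaces `w` by `w l` up to sign, which shifts the moments by one; induction and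
the mean value inequality then give the Taylor bound. -/
lemma exists_abs_expSum_le_pow (s : Finset ι) (l : ι → ℝ) (hl : ∀ i ∈ s, 0 ≤ l i) (m : ℕ)
    (w : ι → ℝ) (hw : ∀ p < m, ∑ i ∈ s, w i * l i ^ p = 0) :
    ∃ C, 0 ≤ C ∧ ∀ u, 0 ≤ u → |expSum s w l u| ≤ C * u ^ m := by
  induction m generalizing w with
  | zero =>
    exact ⟨∑ i ∈ s, |w i|, Finset.sum_nonneg fun _ _ => abs_nonneg _, fun u hu => by
      simpa using abs_expSum_le s w l hl hu⟩
  | succ m ih =>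
    obtain ⟨C, hC, h⟩ := ih (fun i => w i * l i) fun p hp => by
      rw [← hw (p + 1) (by omega)]
      exact Finset.sum_congr rfl fun i _ => by ring
    refine ⟨C, hC, fun u hu => ?_⟩
    have h0 : expSum s w l 0 = 0 := by simpa [expSum] using hw 0 (by omega)
    have := Convex.norm_image_sub_le_of_norm_hasDerivWithin_le (f := expSum s w l)
      (f' := fun x => -expSum s (fun i => w i * l i) l x) (s := Set.Icc 0 u) (C := C * u ^ m)
      (x := 0) (y := u)
      (fun x _ => (hasDerivAt_expSum s w l x).hasDerivWithinAt) (fun x hx => by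
        rw [norm_neg]
        exact (h x hx.1).trans (by have := hx.1; have := hx.2; gcongr)) (convex_Icc 0 u)
      (Set.left_mem_Icc.2 hu) (Set.right_mem_Icc.2 hu)
    rw [h0, sub_zero, sub_zero, Real.norm_eq_abs, Real.norm_of_nonneg hu] at this
    rwa [pow_succ, ← mul_assoc]

/-- Integrability of `u ^ (-ν - 1) * φ u` on `(0, ∞)` for measurable `φ` bounded by `C₀`
and by `C u ^ m`, when `0 < ν < m`. -/
lemma integrableOn_rpow_mul_of_bound {ν : ℝ} (hν : 0 < ν) {m : ℕ} (hm : ν < m) {φ : ℝ → ℝ}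
    (hφ : Measurable φ) {C₀ C : ℝ} (h₀ : ∀ u, 0 < u → |φ u| ≤ C₀)
    (h : ∀ u, 0 < u → |φ u| ≤ C * u ^ m) :
    IntegrableOn (fun u => u ^ (-ν - 1) * φ u) (Set.Ioi 0) := by
  rw [← Set.Ioc_union_Ioi_eq_Ioi (zero_le_one' ℝ)]
  refine IntegrableOn.union ?_ ?_
  · have h1 : IntegrableOn (fun u : ℝ => C * u ^ (m - ν - 1)) (Set.Ioc 0 1) := by
      refine Integrable.const_mul ?_ C
      rw [← IntegrableOn, ← intervalIntegrable_iff_integrableOn_Ioc_of_le zero_le_one]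
      exact intervalIntegral.intervalIntegrable_rpow' (by linarith)
    refine h1.mono' (by fun_prop) ((ae_restrict_mem measurableSet_Ioc).mono fun u hu => ?_)
    have hu0 := hu.1
    rw [norm_mul, Real.norm_of_nonneg (by positivity), Real.norm_eq_abs,
      show (m : ℝ) - ν - 1 = (-ν - 1) + m by ring, Real.rpow_add hu0, Real.rpow_natCast]
    calc _ ≤ u ^ (-ν - 1) * (C * u ^ m) := by gcongr; exact h u hu0
      _ = _ := by ring
  · have h1 : IntegrableOn (fun u : ℝ => C₀ * u ^ (-ν - 1)) (Set.Ioi 1) :=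
      (integrableOn_Ioi_rpow_of_lt (by linarith) one_pos).const_mul C₀
    refine h1.mono' (by fun_prop) ((ae_restrict_mem measurableSet_Ioi).mono fun u hu => ?_)
    have hu0 : 0 < u := one_pos.trans hu
    rw [norm_mul, Real.norm_of_nonneg (by positivity), Real.norm_eq_abs, mul_comm]
    gcongr
    exact h₀ u hu0

lemma integrableOn_rpow_mul_expSum {ν : ℝ} (hν : 0 < ν) {m : ℕ} (hm : ν < m) (s : Finset ι)
    (w l : ι → ℝ) (hl : ∀ i ∈ s, 0 ≤ l i) (hw : ∀ p < m, ∑ i ∈ s, w i * l i ^ p = 0) :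
    IntegrableOn (fun u => u ^ (-ν - 1) * expSum s w l u) (Set.Ioi 0) := by
  obtain ⟨C, _, hC⟩ := exists_abs_expSum_le_pow s l hl m w hw
  exact integrableOn_rpow_mul_of_bound hν hm (continuous_expSum s w l).measurable
    (fun u hu => abs_expSum_le s w l hl hu.le) fun u hu => hC u hu.le

lemma integral_rpow_mul_expSum_of_neg {ν : ℝ} (hν : ν < 0) (s : Finset ι)
    (w l : ι → ℝ) (hl : ∀ i ∈ s, 0 < l i) :
    IntegrableOn (fun u => u ^ (-ν - 1) * expSum s w l u) (Set.Ioi 0) ∧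
    ∫ u in Set.Ioi 0, u ^ (-ν - 1) * expSum s w l u =
      Real.Gamma (-ν) * ∑ i ∈ s, w i * l i ^ ν := by
  have hint : ∀ i ∈ s, IntegrableOn (fun u : ℝ => w i * (u ^ (-ν - 1) * Real.exp (-(l i * u))))
      (Set.Ioi 0) := fun i hi => by
    have := integrableOn_rpow_mul_exp_neg_mul_rpow (p := 1) (s := -ν - 1) (b := l i)
      (by linarith) one_pos (hl i hi)
    simp only [Real.rpow_one, neg_mul] at this
    exact Integrable.const_mul this _
  have e : (fun u : ℝ => u ^ (-ν - 1) * expSum s w l u) =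
      fun u => ∑ i ∈ s, w i * (u ^ (-ν - 1) * Real.exp (-(l i * u))) := by
    ext u
    rw [expSum, Finset.mul_sum]
    exact Finset.sum_congr rfl fun i _ => by ring
  rw [e]
  refine ⟨integrable_finsetSum _ hint, ?_⟩
  rw [integral_finsetSum _ hint, Finset.mul_sum]
  refine Finset.sum_congr rfl fun i hi => ?_
  rw [integral_const_mul, Real.integral_rpow_mul_exp_neg_mul_Ioi (by linarith) (hl i hi), one_div,
    Real.inv_rpow (hl i hi).le, Real.rpow_neg (hl i hi).le, inv_inv]
  ring

/-- The mean value inequality in the exponent produces a factor `u`, which cancels the singularity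
at `0` while an exponential rate `min x 1` survives. -/
lemma integrableOn_inv_mul_exp_sub_exp {x : ℝ} (hx : 0 < x) :
    IntegrableOn (fun u : ℝ => u⁻¹ * (Real.exp (-(x * u)) - Real.exp (-(1 * u)))) (Set.Ioi 0) := by
  have hb : ∀ u : ℝ, 0 < u → |u⁻¹ * (Real.exp (-(x * u)) - Real.exp (-(1 * u)))| ≤
      |x - 1| * Real.exp (-(min x 1) * u) := fun u hu => by
    have hd : ∀ y ∈ Set.uIcc (1 : ℝ) x, HasDerivWithinAt (fun y : ℝ => Real.exp (-(y * u)))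
        (Real.exp (-(y * u)) * (-(1 * u))) (Set.uIcc 1 x) y := fun y _ =>
      (((hasDerivAt_id y).mul_const u).neg.exp).hasDerivWithinAt
    have := Convex.norm_image_sub_le_of_norm_hasDerivWithin_le
      (C := Real.exp (-(min x 1) * u) * u) hd (fun y hy => by
        rw [norm_mul, norm_neg, one_mul, Real.norm_of_nonneg (Real.exp_pos _).le,
          Real.norm_of_nonneg hu.le]
        have : min x 1 ≤ y := by rw [min_comm]; exact hy.1
        have : min x 1 * u ≤ y * u := by gcongr
        gcongr
        linarith) (convex_uIcc 1 x) Set.left_mem_uIcc Set.right_mem_uIcc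
    rw [abs_mul, abs_of_pos (inv_pos.2 hu)]
    calc _ ≤ u⁻¹ * (Real.exp (-(min x 1) * u) * u * |x - 1|) := by gcongr; exact this
      _ = _ := by field_simp
  have hi : IntegrableOn (fun u : ℝ => |x - 1| * Real.exp (-(min x 1) * u)) (Set.Ioi 0) :=
    (exp_neg_integrableOn_Ioi 0 (lt_min hx one_pos)).const_mul _
  exact hi.mono' (by fun_prop) ((ae_restrict_mem measurableSet_Ioi).mono fun u hu => hb u hu)

/-- Since the weights sum to zero, `exp (-u)` can be subtracted from every term, leaving Frullani
integrals. -/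
lemma integral_inv_mul_expSum (s : Finset ι) (w l : ι → ℝ) (hl : ∀ i ∈ s, 0 < l i)
    (hw : ∑ i ∈ s, w i = 0) :
    IntegrableOn (fun u => u⁻¹ * expSum s w l u) (Set.Ioi 0) ∧
    ∫ u in Set.Ioi 0, u⁻¹ * expSum s w l u = - ∑ i ∈ s, w i * Real.log (l i) := by
  have e : (fun u : ℝ => u⁻¹ * expSum s w l u) =
      fun u => ∑ i ∈ s, w i * (u⁻¹ * (Real.exp (-(l i * u)) - Real.exp (-(1 * u)))) := by
    ext u
    have h0 : ∑ i ∈ s, w i * (u⁻¹ * Real.exp (-(1 * u))) = 0 := by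
      rw [← Finset.sum_mul, hw, zero_mul]
    simp_rw [mul_sub, Finset.sum_sub_distrib]
    rw [h0, sub_zero, expSum, Finset.mul_sum]
    exact Finset.sum_congr rfl fun i _ => by ring
  have hint : ∀ i ∈ s, IntegrableOn (fun u : ℝ => w i * (u⁻¹ *
      (Real.exp (-(l i * u)) - Real.exp (-(1 * u))))) (Set.Ioi 0) := fun i hi =>
    (integrableOn_inv_mul_exp_sub_exp (hl i hi)).const_mul _
  rw [e]
  refine ⟨integrable_finsetSum _ hint, ?_⟩
  rw [integral_finsetSum _ hint, ← Finset.sum_neg_distrib]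
  refine Finset.sum_congr rfl fun i hi => ?_
  have := Frullani.integral_Ioi_eq (f := fun x : ℝ => Real.exp (-x)) (a := l i) (b := 1)
    (L := 1) (R := 0) ((Continuous.locallyIntegrable (by fun_prop)).locallyIntegrableOn _) (hl i hi) one_pos
    (by
      have : Continuous fun x : ℝ => Real.exp (-x) := by fun_prop
      simpa using (this.tendsto 0).mono_left nhdsWithin_le_nhds)
    Real.tendsto_exp_neg_atTop_nhds_zero (integrableOn_inv_mul_exp_sub_exp (hl i hi))
  simp only [smul_eq_mul, sub_zero, mul_one, one_div, Real.log_inv] at this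
  rw [integral_const_mul, this]
  ring

/-- Integration by parts. -/
lemma integral_rpow_mul_expSum_by_parts {ν : ℝ} (hν : 0 < ν) {m : ℕ} (hm : ν < m) (s : Finset ι)
    (w l : ι → ℝ) (hl : ∀ i ∈ s, 0 ≤ l i) (hw : ∀ p < m, ∑ i ∈ s, w i * l i ^ p = 0)
    (hint : IntegrableOn (fun u => u ^ (-(ν - 1) - 1) * expSum s (fun i => w i * l i) l u)
      (Set.Ioi 0)) :
    ∫ u in Set.Ioi 0, u ^ (-ν - 1) * expSum s w l u =
      -(1 / ν) * ∫ u in Set.Ioi 0, u ^ (-(ν - 1) - 1) * expSum s (fun i => w i * l i) l u := by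
  obtain ⟨C, hC0, hC⟩ := exists_abs_expSum_le_pow s l hl m w hw
  have hb := fun u (hu : (0 : ℝ) ≤ u) => abs_expSum_le s w l hl hu
  have he : -(ν - 1) - 1 = -ν := by ring
  rw [he] at hint ⊢
  -- The boundary term is `O(u^(m-ν))` at `0` by the vanishing moments, and `O(u^(-ν))` at infinity
  -- by boundedness.
  have h0 : Tendsto (fun u : ℝ => expSum s w l u * u ^ (-ν)) (𝓝[>] 0) (𝓝 0) := by
    have : Tendsto (fun u : ℝ => C * u ^ (m - ν)) (𝓝[>] 0) (𝓝 0) := by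
      have h1 : ContinuousAt (fun u : ℝ => C * u ^ (m - ν)) 0 :=
        (Real.continuousAt_rpow_const 0 _ (Or.inr (by linarith))).const_mul C
      have h2 := h1.tendsto.mono_left (nhdsWithin_le_nhds (s := Set.Ioi 0))
      simpa [Real.zero_rpow (show (m : ℝ) - ν ≠ 0 by linarith)] using h2
    refine squeeze_zero_norm' ?_ this
    filter_upwards [self_mem_nhdsWithin] with u (hu : 0 < u)
    rw [norm_mul, Real.norm_of_nonneg (Real.rpow_nonneg hu.le _), Real.norm_eq_abs, sub_eq_add_neg,
      Real.rpow_add hu, Real.rpow_natCast, ← mul_assoc]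
    gcongr
    exact hC u hu.le
  have hinf : Tendsto (fun u : ℝ => expSum s w l u * u ^ (-ν)) atTop (𝓝 0) := by
    have : Tendsto (fun u : ℝ => (∑ i ∈ s, |w i|) * u ^ (-ν)) atTop (𝓝 0) := by
      simpa using (tendsto_rpow_neg_atTop hν).const_mul (∑ i ∈ s, |w i|)
    refine squeeze_zero_norm' ?_ this
    filter_upwards [eventually_gt_atTop 0] with u hu
    rw [norm_mul, Real.norm_of_nonneg (Real.rpow_nonneg hu.le _), Real.norm_eq_abs]
    gcongr
    exact hb u hu.le
  have hint1 := integrableOn_rpow_mul_expSum hν hm s w l hl hw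
  have := integral_Ioi_mul_deriv_eq_deriv_mul (a := (0 : ℝ)) (a' := 0) (b' := 0)
    (u := expSum s w l) (u' := fun u => -expSum s (fun i => w i * l i) l u)
    (v := fun u => u ^ (-ν)) (v' := fun u => (-ν) * u ^ (-ν - 1))
    (fun u _ => hasDerivAt_expSum s w l u)
    (fun u hu => Real.hasDerivAt_rpow_const (Or.inl (ne_of_gt hu)))
    ((hint1.const_mul (-ν)).congr (ae_of_all _ fun u => by simp only [Pi.mul_apply]; ring))
    (hint.neg.congr (ae_of_all _ fun u => by simp only [Pi.mul_apply, Pi.neg_apply]; ring)) h0 hinf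
  have e1 : ∀ u : ℝ, expSum s w l u * (-ν * u ^ (-ν - 1)) =
    -ν * (u ^ (-ν - 1) * expSum s w l u) := fun u => by ring
  have e2 : ∀ u : ℝ, -expSum s (fun i => w i * l i) l u * u ^ (-ν) =
    -(u ^ (-ν) * expSum s (fun i => w i * l i) l u) := fun u => by ring
  simp only [e1, e2, integral_const_mul, integral_neg] at this
  field_simp
  linarith

/-- Each integration by parts lowers `ν` and `m` by one and is matched by `Γ(-ν+1) = -ν Γ(-ν)`. The
descent stops once `ν < 0`, where each term is an ordinary Gamma integral. -/
lemma integral_rpow_mul_expSum_of_not_int (s : Finset ι) (l : ι → ℝ) (hl : ∀ i ∈ s, 0 < l i)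
    (m : ℕ) {ν : ℝ} (hν : ∀ k : ℤ, ν ≠ k) (hm : ν < m) (w : ι → ℝ)
    (hw : ∀ p < m, ∑ i ∈ s, w i * l i ^ p = 0) :
    IntegrableOn (fun u => u ^ (-ν - 1) * expSum s w l u) (Set.Ioi 0) ∧
    ∫ u in Set.Ioi 0, u ^ (-ν - 1) * expSum s w l u =
      Real.Gamma (-ν) * ∑ i ∈ s, w i * l i ^ ν := by
  induction m generalizing ν w with
  | zero => exact integral_rpow_mul_expSum_of_neg (by simpa using hm) s w l hl
  | succ m ih =>
    rcases lt_or_gt_of_ne (by simpa using hν 0) with h0 | h0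
    · exact integral_rpow_mul_expSum_of_neg h0 s w l hl
    · have hl' : ∀ i ∈ s, 0 ≤ l i := fun i hi => (hl i hi).le
      obtain ⟨h1, h2⟩ := ih (ν := ν - 1) (fun k hk => hν (k + 1) (by push_cast; linarith))
        (by push_cast at hm; linarith) (fun i => w i * l i) fun p hp => by
          rw [← hw (p + 1) (by omega)]
          exact Finset.sum_congr rfl fun i _ => by ring
      refine ⟨integrableOn_rpow_mul_expSum h0 hm s w l hl' hw, ?_⟩
      rw [integral_rpow_mul_expSum_by_parts h0 hm s w l hl' hw h1, h2, show -(ν - 1) = -ν + 1 by ring,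
        Real.Gamma_add_one (by linarith)]
      have : ∑ i ∈ s, w i * l i * l i ^ (ν - 1) = ∑ i ∈ s, w i * l i ^ ν :=
        Finset.sum_congr rfl fun i hi => by
          rw [Real.rpow_sub_one (hl i hi).ne']
          have := (hl i hi).ne'
          field_simp
      rw [this]
      field_simp

/-- For integer order the same descent ends at exponent `-1`, where Frullani's integral supplies the
logarithm. -/
lemma integral_rpow_mul_expSum_of_nat (s : Finset ι) (l : ι → ℝ) (hl : ∀ i ∈ s, 0 < l i)
    (k : ℕ) {m : ℕ} (hm : k < m) (w : ι → ℝ)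
    (hw : ∀ p < m, ∑ i ∈ s, w i * l i ^ p = 0) :
    IntegrableOn (fun u => u ^ (-(k : ℝ) - 1) * expSum s w l u) (Set.Ioi 0) ∧
    ∫ u in Set.Ioi 0, u ^ (-(k : ℝ) - 1) * expSum s w l u =
      (-1) ^ (k + 1) / (k.factorial : ℝ) * ∑ i ∈ s, w i * (l i ^ k * Real.log (l i)) := by
  induction k generalizing m w with
  | zero =>
    have := integral_inv_mul_expSum s w l hl (by simpa using hw 0 hm)
    simpa [Real.rpow_neg_one] using this
  | succ k ih =>
    obtain ⟨m, rfl⟩ : ∃ m', m = m' + 1 := ⟨m - 1, by omega⟩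
    have hl' : ∀ i ∈ s, 0 ≤ l i := fun i hi => (hl i hi).le
    obtain ⟨h1, h2⟩ := ih (m := m) (by omega) (fun i => w i * l i) fun p hp => by
      rw [← hw (p + 1) (by omega)]
      exact Finset.sum_congr rfl fun i _ => by ring
    have e : (k : ℝ) = ((k + 1 : ℕ) : ℝ) - 1 := by push_cast; ring
    rw [e] at h1 h2
    have h0 : (0 : ℝ) < ((k + 1 : ℕ) : ℝ) := by positivity
    have hm' : ((k + 1 : ℕ) : ℝ) < ((m + 1 : ℕ) : ℝ) := by exact_mod_cast hm
    refine ⟨integrableOn_rpow_mul_expSum h0 hm' s w l hl' hw, ?_⟩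
    rw [integral_rpow_mul_expSum_by_parts h0 hm' s w l hl' hw h1, h2, Nat.factorial_succ]
    have : ∑ i ∈ s, w i * l i * (l i ^ k * Real.log (l i)) =
        ∑ i ∈ s, w i * (l i ^ (k + 1) * Real.log (l i)) :=
      Finset.sum_congr rfl fun i hi => by ring
    rw [this]
    push_cast
    field_simp
    ring

/-- Euler's reflection formula at `-ν` identifies the constant in `G_ν`. The root appears because
the exponents `l` are squared distances. -/
lemma irregularTerm_sqrt_of_not_int {ν : ℝ} (hν0 : 0 < ν) (hν : ∀ k : ℤ, ν ≠ k) {l : ℝ}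
    (hl : 0 < l) :
    Real.Gamma ν * 4 ^ ν * irregularTerm ν √l = Real.Gamma (-ν) * l ^ ν := by
  have hΓ := Real.Gamma_pos_of_pos hν0
  have hΓ1 := Real.Gamma_pos_of_pos (show 0 < ν + 1 by linarith)
  have h4 : (2 : ℝ) ^ (2 * ν) = 4 ^ ν := by
    rw [Real.rpow_mul (by norm_num)]; norm_num
  have hsin : Real.sin (ν * Real.pi) ≠ 0 := fun h => by
    obtain ⟨k, hk⟩ := Real.sin_eq_zero_iff.1 h
    exact hν k (mul_right_cancel₀ Real.pi_ne_zero hk.symm)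
  have hr := Real.Gamma_mul_Gamma_one_sub (-ν)
  rw [show 1 - -ν = ν + 1 by ring, show Real.pi * -ν = -(ν * Real.pi) by ring, Real.sin_neg] at hr
  have hls : √l ^ (2 * ν) = l ^ ν := by
    rw [Real.rpow_mul (Real.sqrt_nonneg l), Real.rpow_two, Real.sq_sqrt hl.le]
  rw [irregularTerm, if_neg (Real.sqrt_pos.2 hl).ne', if_neg (by push Not; exact hν), hls, h4,
    eq_div_of_mul_eq hΓ1.ne' hr]
  field_simp

lemma irregularTerm_sqrt_of_nat {k : ℕ} (hk : 0 < k) {l : ℝ} (hl : 0 < l) :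
    Real.Gamma k * 4 ^ (k : ℝ) * irregularTerm k √l =
      (-1) ^ (k + 1) / (k.factorial : ℝ) * (l ^ k * Real.log l) := by
  have hΓ := Real.Gamma_pos_of_pos (show (0 : ℝ) < k by exact_mod_cast hk)
  have h4 : (2 : ℝ) ^ (2 * (k : ℝ) - 1) = 4 ^ (k : ℝ) / 2 := by
    rw [Real.rpow_sub_one (by norm_num), Real.rpow_mul (by norm_num)]; norm_num
  have hls : √l ^ (2 * (k : ℝ)) = l ^ k := by
    rw [Real.rpow_mul (Real.sqrt_nonneg l), Real.rpow_two, Real.sq_sqrt hl.le, Real.rpow_natCast]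
  rw [irregularTerm, if_neg (Real.sqrt_pos.2 hl).ne', if_pos ⟨k, by simp⟩, hls, h4,
    Real.Gamma_nat_eq_factorial, Int.floor_natCast, Real.log_sqrt hl.le]
  have : (-1 : ℝ) ^ ((k : ℤ) + 1) = (-1) ^ (k + 1) := by exact_mod_cast zpow_natCast (-1 : ℝ) (k + 1)
  rw [this]
  field_simp

/-- The regularised Gamma integral in terms of the principal irregular term. -/
theorem integral_rpow_mul_expSum_eq_irregularTerm {ν : ℝ} (hν : 0 < ν) {m : ℕ} (hm : ν < m)
    (s : Finset ι) (w l : ι → ℝ) (hl : ∀ i ∈ s, 0 ≤ l i)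
    (hw : ∀ p < m, ∑ i ∈ s, w i * l i ^ p = 0) :
    ∫ u in Set.Ioi 0, u ^ (-ν - 1) * expSum s w l u =
      Real.Gamma ν * 4 ^ ν * ∑ i ∈ s, w i * irregularTerm ν √(l i) := by
  classical
  obtain ⟨m, rfl⟩ : ∃ m', m = m' + 1 := by
    refine ⟨m - 1, ?_⟩
    have : (0 : ℝ) < m := hν.trans hm
    have : 0 < m := by exact_mod_cast this
    omega
  -- The evaluations by Gamma and Frullani need `l i > 0`. One integration by parts multiplies the
  -- weights by `l i`, so terms with `l i = 0` drop out; they do so on the other side because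
  -- `irregularTerm ν 0 = 0`.
  set s' := s.filter fun i => l i ≠ 0
  have hl' : ∀ i ∈ s', 0 < l i := fun i hi =>
    lt_of_le_of_ne (hl i (Finset.mem_filter.1 hi).1) (Finset.mem_filter.1 hi).2.symm
  have hsum : ∀ f : ι → ℝ, (∀ i, l i = 0 → f i = 0) → ∑ i ∈ s', f i = ∑ i ∈ s, f i := fun f hf =>
    Finset.sum_filter_of_ne fun i _ hi h0 => hi (hf i h0)
  have hexp : expSum s (fun i => w i * l i) l = expSum s' (fun i => w i * l i) l := by
    ext u
    exact (hsum _ fun i hi => by simp [hi]).symm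
  have hw' : ∀ p < m, ∑ i ∈ s', w i * l i * l i ^ p = 0 := fun p hp => by
    rw [hsum _ fun i hi => by simp [hi], ← hw (p + 1) (by omega)]
    exact Finset.sum_congr rfl fun i _ => by ring
  have hs : ∑ i ∈ s, w i * irregularTerm ν √(l i) = ∑ i ∈ s', w i * irregularTerm ν √(l i) :=
    (hsum _ fun i hi => by simp [hi, irregularTerm]).symm
  rw [hs, Finset.mul_sum]
  by_cases hint : ∃ k : ℤ, ν = k
  · obtain ⟨k, hk⟩ := hint
    obtain ⟨k, rfl⟩ : ∃ j : ℕ, k = j + 1 := by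
      have : (0 : ℝ) < k := hk ▸ hν
      have : 0 < k := by exact_mod_cast this
      exact ⟨(k - 1).toNat, by omega⟩
    have hk' : ν = ((k + 1 : ℕ) : ℝ) := by rw [hk]; push_cast; ring
    have hk1 : ν - 1 = k := by rw [hk']; push_cast; ring
    have hkm : k < m := by rw [hk'] at hm; exact_mod_cast Nat.lt_of_succ_lt_succ (by exact_mod_cast hm)
    obtain ⟨h1, h2⟩ := integral_rpow_mul_expSum_of_nat s' l hl' k hkm (fun i => w i * l i) hw'
    rw [← hexp, ← hk1] at h1 h2
    rw [integral_rpow_mul_expSum_by_parts hν hm s w l hl hw h1, h2, Finset.mul_sum, Finset.mul_sum]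
    refine Finset.sum_congr rfl fun i hi => ?_
    rw [mul_left_comm _ (w i), hk', irregularTerm_sqrt_of_nat k.succ_pos (hl' i hi),
      Nat.factorial_succ]
    simp only [Nat.succ_eq_add_one, pow_succ]
    push_cast
    field_simp
  · push Not at hint
    obtain ⟨h1, h2⟩ := integral_rpow_mul_expSum_of_not_int s' l hl' m (ν := ν - 1)
      (fun k hk => hint (k + 1) (by push_cast; linarith)) (by push_cast at hm; linarith)
      (fun i => w i * l i) hw'
    rw [← hexp] at h1 h2
    rw [integral_rpow_mul_expSum_by_parts hν hm s w l hl hw h1, h2, Finset.mul_sum, Finset.mul_sum]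
    refine Finset.sum_congr rfl fun i hi => ?_
    rw [mul_left_comm _ (w i), irregularTerm_sqrt_of_not_int hν hint (hl' i hi),
      show -(ν - 1) = -ν + 1 by ring, Real.Gamma_add_one (by linarith),
      Real.rpow_sub_one (hl' i hi).ne']
    have := (hl' i hi).ne'
    field_simp

/-- The limit of the rescaled mixtures of exponential sums. -/
theorem tendsto_integral_mixDensity_mul_expSum {ν a : ℝ} (hν : 0 < ν) (ha : 0 < a) {m : ℕ}
    (hm : ν < m) (s : Finset ι) (w l : ι → ℝ) (hl : ∀ i ∈ s, 0 ≤ l i)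
    (hw : ∀ p < m, ∑ i ∈ s, w i * l i ^ p = 0) {r : ℕ → ℝ} (hr : ∀ᶠ n in atTop, 0 < r n)
    (hr0 : Tendsto r atTop (𝓝 0)) :
    Tendsto (fun n => r n ^ (-ν) * ∫ u in Set.Ioi 0, mixDensity ν a u * expSum s w l (r n * u))
      atTop (𝓝 (∫ u in Set.Ioi 0, u ^ (-ν - 1) * expSum s w l u)) := by
  -- Replacing `u` by `u / r n` absorbs the factor `r n ^ (-ν)` and moves the scale into `exp (-(a *
  -- r n / u))`, which is at most `1` and tends to `1`.
  have hscale : ∀ n, 0 < r n → r n ^ (-ν) *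
      ∫ u in Set.Ioi 0, mixDensity ν a u * expSum s w l (r n * u) =
      ∫ u in Set.Ioi 0, u ^ (-ν - 1) * expSum s w l u * Real.exp (-(a * r n / u)) := fun n hn => by
    have h1 := integral_comp_mul_left_Ioi'
      (fun u => u ^ (-ν - 1) * expSum s w l u * Real.exp (-(a * r n / u))) 0 hn
    rw [mul_zero] at h1
    rw [← h1, smul_eq_mul, ← integral_const_mul, ← integral_const_mul]
    refine setIntegral_congr_fun measurableSet_Ioi fun u (hu : 0 < u) => ?_
    simp only [mixDensity]
    rw [Real.mul_rpow hn.le hu.le, Real.rpow_sub_one hn.ne']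
    have : a * r n / (r n * u) = a / u := by field_simp
    rw [this]
    field_simp
  have hlim : Tendsto (fun n => ∫ u in Set.Ioi 0,
      u ^ (-ν - 1) * expSum s w l u * Real.exp (-(a * r n / u))) atTop
      (𝓝 (∫ u in Set.Ioi 0, u ^ (-ν - 1) * expSum s w l u)) := by
    have hc := continuous_expSum s w l
    refine tendsto_integral_filter_of_dominated_convergence
      (fun u => ‖u ^ (-ν - 1) * expSum s w l u‖) ?_ ?_
      (integrableOn_rpow_mul_expSum hν hm s w l hl hw).norm ?_
    · exact Eventually.of_forall fun n => by
        have := hc.measurable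
        exact Measurable.aestronglyMeasurable (by fun_prop)
    · filter_upwards [hr] with n hn
      refine (ae_restrict_mem measurableSet_Ioi).mono fun u (hu : 0 < u) => ?_
      rw [norm_mul _ (Real.exp _), Real.norm_of_nonneg (Real.exp_pos _).le]
      refine mul_le_of_le_one_right (norm_nonneg _) (Real.exp_le_one_iff.2 ?_)
      have : 0 < a * r n / u := by positivity
      linarith
    · refine ae_of_all _ fun u => ?_
      have h1 : Tendsto (fun n => Real.exp (-(a * r n / u))) atTop (𝓝 1) := by
        have : Tendsto (fun n => -(a * r n / u)) atTop (𝓝 0) := by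
          simpa using ((hr0.const_mul a).div_const u).neg
        simpa [Function.comp_def] using (Real.continuous_exp.tendsto 0).comp this
      simpa using h1.const_mul (u ^ (-ν - 1) * expSum s w l u)
  exact hlim.congr' (by filter_upwards [hr] with n hn; exact (hscale n hn).symm)

end ExpSum

/-! ### Covariances of `m`-th differences: decay in the lag and limit at lag zero -/

section

/-- The coefficients of the square of the `m`-th order difference operator. -/
def diffCoeff (m i j : ℕ) : ℝ := (-1 : ℝ) ^ (i + j) * (m.choose i : ℝ) * (m.choose j : ℝ)

lemma neg_one_pow_sub_of_le {m i : ℕ} (h : i ≤ m) : (-1 : ℝ) ^ (m - i) = (-1) ^ m * (-1) ^ i := by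
  obtain ⟨k, rfl⟩ := Nat.exists_eq_add_of_le h
  rw [Nat.add_sub_cancel_left, pow_add]
  have : ((-1 : ℝ) ^ i) * (-1) ^ i = 1 := by rw [← mul_pow]; norm_num
  linear_combination (-(-1 : ℝ) ^ k) * this

lemma fwdDiff_iter_eq_sum_real {M : Type*} [AddCommMonoid M] (h : M) (f : M → ℝ) (m : ℕ) (y : M) :
    (fwdDiff h)^[m] f y =
      ∑ k ∈ Finset.range (m + 1), (-1 : ℝ) ^ m * (-1) ^ k * (m.choose k : ℝ) * f (y + k • h) := by
  rw [fwdDiff_iter_eq_sum_shift]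
  refine Finset.sum_congr rfl fun k hk => ?_
  rw [← neg_one_pow_sub_of_le (Finset.mem_range_succ_iff.1 hk), zsmul_eq_mul]
  push_cast
  rfl

/-- The reflection `j ↦ m - j` turns the difference in `-j` into a forward one, so two `m`-th
differences compose into one of order `2m`, centred at `0`. -/
lemma sum_diffCoeff_mul (m : ℕ) (f : ℝ → ℝ) :
    ∑ i ∈ Finset.range (m + 1), ∑ j ∈ Finset.range (m + 1), diffCoeff m i j * f ((i : ℝ) - j) =
      (-1) ^ m * (fwdDiff (1 : ℝ))^[2 * m] f (-m) := by
  rw [two_mul, Function.iterate_add_apply, fwdDiff_iter_eq_sum_real, Finset.mul_sum,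
    Finset.sum_comm, ← Finset.sum_range_reflect]
  refine Finset.sum_congr rfl fun k hk => ?_
  have hk := Finset.mem_range_succ_iff.1 hk
  rw [fwdDiff_iter_eq_sum_real, Finset.mul_sum, Finset.mul_sum]
  refine Finset.sum_congr rfl fun i hi => ?_
  have hm : ((-1 : ℝ) ^ m) * (-1) ^ m = 1 := by rw [← mul_pow]; norm_num
  have e : (i : ℝ) - ((m + 1 - 1 - k : ℕ) : ℝ) = -m + k • 1 + i • 1 := by
    rw [Nat.add_sub_cancel, Nat.cast_sub hk]
    simp
    ring
  rw [e, diffCoeff, Nat.add_sub_cancel, Nat.choose_symm hk, pow_add, neg_one_pow_sub_of_le hk]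
  linear_combination (-(-1 : ℝ) ^ m * (-1) ^ k * (-1) ^ i * (m.choose i) * (m.choose k) *
    f (-m + k • 1 + i • 1)) * hm

lemma sum_diffCoeff_mul_sq_pow {m p : ℕ} (hp : p < m) :
    ∑ i ∈ Finset.range (m + 1), ∑ j ∈ Finset.range (m + 1),
      diffCoeff m i j * (((i : ℝ) - j) ^ 2) ^ p = 0 := by
  rw [sum_diffCoeff_mul m fun x => (x ^ 2) ^ p]
  simp_rw [← pow_mul]
  rw [fwdDiff_iter_pow_eq_zero_of_lt (by omega)]
  simp

/-- Iterated forward differences are bounded by iterated derivatives. -/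
lemma abs_fwdDiff_iter_le (n : ℕ) (F : ℕ → ℝ → ℝ)
    (hF : ∀ k x, HasDerivAt (F k) (F (k + 1) x) x) {x C : ℝ}
    (hC : ∀ y ∈ Set.Icc x (x + n), |F n y| ≤ C) : |(fwdDiff (1 : ℝ))^[n] (F 0) x| ≤ C := by
  induction n generalizing F with
  | zero => simpa using hC x (by simp)
  | succ n ih =>
    rw [Function.iterate_succ_apply]
    refine ih (fun k => fwdDiff 1 (F k)) (fun k y => ?_) fun y hy => ?_
    · exact ((hF k (y + 1)).comp_add_const y 1).sub (hF k y)
    · have := Convex.norm_image_sub_le_of_norm_hasDerivWithin_le (f := F n) (f' := F (n + 1))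
        (C := C) (s := Set.Icc y (y + 1)) (x := y) (y := y + 1)
        (fun z _ => (hF n z).hasDerivWithinAt) (fun z hz => hC z
          ⟨hy.1.trans hz.1, by push_cast; linarith [hz.2, hy.2]⟩) (convex_Icc _ _)
        (by simp) (by simp)
      simpa [fwdDiff] using this

/-- The rate `1/4` is chosen so that half of the Gaussian decay `exp (-y²/2)` remains after
absorbing a Hermite polynomial. -/
lemma exists_abs_eval_le_exp (p : Polynomial ℝ) :
    ∃ C, 0 ≤ C ∧ ∀ y, |p.eval y| ≤ C * Real.exp (y ^ 2 / 4) := by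
  induction p using Polynomial.induction_on' with
  | add p q hp hq =>
    obtain ⟨C, hC, h⟩ := hp
    obtain ⟨C', hC', h'⟩ := hq
    refine ⟨C + C', by positivity, fun y => ?_⟩
    rw [Polynomial.eval_add, add_mul]
    exact (abs_add_le _ _).trans (add_le_add (h y) (h' y))
  | monomial n a =>
    refine ⟨|a| * (1 + 4 ^ n * n.factorial), by positivity, fun y => ?_⟩
    rw [Polynomial.eval_monomial, abs_mul, mul_assoc]
    refine mul_le_mul_of_nonneg_left ?_ (abs_nonneg a)
    have h1 : |y ^ n| ≤ 1 + (y ^ 2) ^ n := by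
      rw [← pow_mul, mul_comm, pow_mul, ← sq_abs (y ^ n)]
      nlinarith [sq_nonneg (|y ^ n| - 1), abs_nonneg (y ^ n)]
    have h2 : (y ^ 2) ^ n ≤ 4 ^ n * n.factorial * Real.exp (y ^ 2 / 4) := by
      have := Real.pow_div_factorial_le_exp (y ^ 2 / 4) (by positivity) n
      rw [div_pow, div_div, div_le_iff₀ (by positivity)] at this
      linarith
    have h3 : 1 ≤ Real.exp (y ^ 2 / 4) := Real.one_le_exp (by positivity)
    linarith

/-- The iterated derivatives of the Gaussian `exp (-y ^ 2 / 2)`. -/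
def gaussDeriv (k : ℕ) : ℝ → ℝ := deriv^[k] fun y => Real.exp (-(y ^ 2 / 2))

lemma gaussDeriv_eq (k : ℕ) : gaussDeriv k = fun x =>
    (-1 : ℝ) ^ k * Polynomial.aeval x (Polynomial.hermite k) * Real.exp (-(x ^ 2 / 2)) :=
  funext fun x => Polynomial.deriv_gaussian_eq_hermite_mul_gaussian k x

lemma hasDerivAt_gaussDeriv (k : ℕ) (x : ℝ) :
    HasDerivAt (gaussDeriv k) (gaussDeriv (k + 1) x) x := by
  have hd : DifferentiableAt ℝ (gaussDeriv k) x := by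
    rw [gaussDeriv_eq]
    have := Polynomial.differentiable_aeval (𝕜 := ℝ) (Polynomial.hermite k)
    fun_prop
  have := hd.hasDerivAt
  rwa [show deriv (gaussDeriv k) x = gaussDeriv (k + 1) x by
    rw [gaussDeriv, gaussDeriv, Function.iterate_succ_apply']] at this

lemma exists_abs_gaussDeriv_le (k : ℕ) :
    ∃ C, 0 ≤ C ∧ ∀ y, |gaussDeriv k y| ≤ C * Real.exp (-(y ^ 2 / 4)) := by
  obtain ⟨C, hC, h⟩ := exists_abs_eval_le_exp
    ((Polynomial.hermite k).map (algebraMap ℤ ℝ))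
  refine ⟨C, hC, fun y => ?_⟩
  have := h y
  rw [Polynomial.eval_map_algebraMap] at this
  rw [gaussDeriv_eq]
  simp only [abs_mul, abs_pow, abs_neg, abs_one, one_pow, one_mul, Real.abs_exp]
  calc _ ≤ C * Real.exp (y ^ 2 / 4) * Real.exp (-(y ^ 2 / 2)) := by gcongr
    _ = _ := by rw [mul_assoc, ← Real.exp_add]; ring_nf

variable {E : Type*} [NormedAddCommGroup E] [InnerProductSpace ℝ E]

/-- Along the line `v + r w` the function is a constant times a standard Gaussian in `c (r + r₀)`,
so its `2m`-th derivative carries the factor `c^(2m) = (2u‖w‖²)^m`. The separation hypothesis keeps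
`‖v + y w‖ ≥ ‖v‖/2` for `|y| ≤ m`, which preserves the decay in `‖v‖`. -/
lemma exists_abs_fwdDiff_gaussian_le (m : ℕ) : ∃ C, 0 ≤ C ∧ ∀ (v w : E) (u : ℝ), 0 < u → w ≠ 0 →
    2 * m * ‖w‖ ≤ ‖v‖ →
    |(fwdDiff (1 : ℝ))^[2 * m] (fun r : ℝ => Real.exp (-(‖v + r • w‖ ^ 2 * u))) (-m)| ≤
      C * (u * ‖w‖ ^ 2) ^ m * Real.exp (-(‖v‖ ^ 2 / 8 * u)) := by
  obtain ⟨C, hC, hg⟩ := exists_abs_gaussDeriv_le (2 * m)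
  refine ⟨C * 2 ^ m, by positivity, fun v w u hu hw hvw => ?_⟩
  have hwn : 0 < ‖w‖ := norm_pos_iff.2 hw
  set b : ℝ := inner ℝ v w
  set c : ℝ := √(2 * u) * ‖w‖ with hc
  have hc2 : c ^ 2 = 2 * u * ‖w‖ ^ 2 := by rw [hc, mul_pow, Real.sq_sqrt (by positivity)]
  -- `κ` is `u` times the squared distance from the origin to the line; Cauchy–Schwarz makes it
  -- nonnegative.
  set κ : ℝ := (‖v‖ ^ 2 - b ^ 2 / ‖w‖ ^ 2) * u with hκ
  have hκ0 : 0 ≤ κ := by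
    refine mul_nonneg (sub_nonneg.2 ?_) hu.le
    rw [div_le_iff₀ (by positivity), ← mul_pow]
    exact sq_le_sq' (by linarith [neg_le_of_abs_le (abs_real_inner_le_norm v w)])
      (real_inner_le_norm v w)
  set r₀ : ℝ := b / ‖w‖ ^ 2 with hr₀
  have hquad : ∀ r : ℝ, ‖v + r • w‖ ^ 2 * u = κ + (c * (r + r₀)) ^ 2 / 2 := fun r => by
    rw [norm_add_sq_real, inner_smul_right, norm_smul, mul_pow, Real.norm_eq_abs, sq_abs, mul_pow c,
      hc2, hκ, hr₀]
    change (‖v‖ ^ 2 + 2 * (r * b) + r ^ 2 * ‖w‖ ^ 2) * u = _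
    field_simp
    ring
  set F : ℕ → ℝ → ℝ := fun k r => Real.exp (-κ) * (c ^ k * gaussDeriv k (c * (r + r₀))) with hF
  have hF0 : (fun r : ℝ => Real.exp (-(‖v + r • w‖ ^ 2 * u))) = F 0 := by
    ext r
    rw [hquad, neg_add, Real.exp_add]
    simp [F, gaussDeriv]
  rw [hF0]
  refine abs_fwdDiff_iter_le (2 * m) F (fun k x => ?_) fun y hy => ?_
  · have h1 : HasDerivAt (fun r => c * (r + r₀)) (c * 1) x :=
      ((hasDerivAt_id x).add_const r₀).const_mul c
    have h2 := (((hasDerivAt_gaussDeriv k _).comp x h1).const_mul (c ^ k)).const_mul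
      (Real.exp (-κ))
    refine h2.congr_deriv ?_
    simp only [F]
    ring
  · have hy' : |y| ≤ m := abs_le.2 ⟨hy.1, by have := hy.2; push_cast at this; linarith⟩
    have hvy : ‖v‖ / 2 ≤ ‖v + y • w‖ := by
      have h1 : ‖v‖ ≤ ‖v + y • w‖ + ‖y • w‖ := by
        simpa using norm_sub_le (v + y • w) (y • w)
      have h2 : ‖y • w‖ ≤ m * ‖w‖ := by
        rw [norm_smul, Real.norm_eq_abs]; gcongr
      linarith
    have hvy2 : ‖v‖ ^ 2 / 4 * u ≤ κ + (c * (y + r₀)) ^ 2 / 2 := by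
      rw [← hquad]
      have : (‖v‖ / 2) ^ 2 ≤ ‖v + y • w‖ ^ 2 := by gcongr
      have : ‖v‖ ^ 2 / 4 ≤ ‖v + y • w‖ ^ 2 := by linarith
      gcongr
    simp only [F]
    rw [abs_mul, abs_mul, Real.abs_exp, pow_mul, hc2, abs_of_nonneg (by positivity)]
    calc _ ≤ Real.exp (-κ) * ((2 * u * ‖w‖ ^ 2) ^ m * (C * Real.exp (-((c * (y + r₀)) ^ 2 / 4)))) := by
          gcongr; exact hg _
      _ = C * 2 ^ m * (u * ‖w‖ ^ 2) ^ m * Real.exp (-κ - (c * (y + r₀)) ^ 2 / 4) := by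
          rw [Real.exp_sub, Real.exp_neg (_ / 4), mul_assoc 2, mul_pow]; ring
      -- As `κ ≥ 0`, the exponent is at most minus half of `κ + (c (y + r₀))²/2`, and `hvy2` bounds
      -- this half below by `‖v‖² u / 8`.
      _ ≤ _ := by gcongr; linarith

/-- The covariance of two `m`-th order differences with common step `w` at lag `v`. -/
def covDiff (σ α ν : ℝ) (m : ℕ) (v w : E) : ℝ :=
  ∑ i ∈ Finset.range (m + 1), ∑ j ∈ Finset.range (m + 1),
    diffCoeff m i j * covFun σ α ν ‖v + ((i : ℝ) - j) • w‖

lemma covDiff_eq_integral {σ α ν : ℝ} (hα : 0 < α) (hν : 0 < ν) (m : ℕ) (v w : E) :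
    covDiff σ α ν m v w = σ ^ 2 * (α ^ 2 / 4) ^ ν / Real.Gamma ν *
      ∫ u in Set.Ioi 0, mixDensity ν (α ^ 2 / 4) u *
        ∑ i ∈ Finset.range (m + 1), ∑ j ∈ Finset.range (m + 1),
          diffCoeff m i j * Real.exp (-(‖v + ((i : ℝ) - j) • w‖ ^ 2 * u)) := by
  have hint : ∀ i j : ℕ, IntegrableOn (fun u => diffCoeff m i j * (mixDensity ν (α ^ 2 / 4) u *
      Real.exp (-(‖v + ((i : ℝ) - j) • w‖ ^ 2 * u)))) (Set.Ioi 0) := fun i j =>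
    (integrableOn_mixDensity_mul_exp hν (by positivity) (by positivity)).const_mul _
  have e : ∀ u, mixDensity ν (α ^ 2 / 4) u *
        ∑ i ∈ Finset.range (m + 1), ∑ j ∈ Finset.range (m + 1),
          diffCoeff m i j * Real.exp (-(‖v + ((i : ℝ) - j) • w‖ ^ 2 * u)) =
      ∑ i ∈ Finset.range (m + 1), ∑ j ∈ Finset.range (m + 1), diffCoeff m i j *
        (mixDensity ν (α ^ 2 / 4) u * Real.exp (-(‖v + ((i : ℝ) - j) • w‖ ^ 2 * u))) := fun u => by
    simp_rw [Finset.mul_sum]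
    exact Finset.sum_congr rfl fun i _ => Finset.sum_congr rfl fun j _ => by ring
  simp_rw [e]
  rw [integral_finsetSum _ fun i _ => integrable_finsetSum _ fun j _ => hint i j, covDiff,
    Finset.mul_sum]
  refine Finset.sum_congr rfl fun i _ => ?_
  rw [integral_finsetSum _ fun j _ => hint i j, Finset.mul_sum]
  refine Finset.sum_congr rfl fun j _ => ?_
  rw [integral_const_mul, covFun_eq_integral hα hν (norm_nonneg _)]
  ring

/-- Dropping `exp (-α²/(4u))` leaves the integral of `u^(m-ν-1) exp (-‖v‖² u/8)`, a Gamma integral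
convergent because `ν < m`, of size `‖v‖^(2(ν-m))`. -/
theorem exists_abs_covDiff_le {σ α ν : ℝ} (hα : 0 < α) (hν : 0 < ν) {m : ℕ} (hm : ν < m) :
    ∃ C, 0 ≤ C ∧ ∀ v w : E, w ≠ 0 → v ≠ 0 → 2 * m * ‖w‖ ≤ ‖v‖ →
      |covDiff σ α ν m v w| ≤ C * ‖w‖ ^ (2 * ν) * (‖v‖ / ‖w‖) ^ (2 * (ν - m)) := by
  obtain ⟨C, hC, h⟩ := exists_abs_fwdDiff_gaussian_le (E := E) m
  have hΓ := Real.Gamma_pos_of_pos hν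
  have hΓ' := Real.Gamma_pos_of_pos (sub_pos.2 hm)
  refine ⟨σ ^ 2 * (α ^ 2 / 4) ^ ν / Real.Gamma ν * (C * 8 ^ (m - ν) * Real.Gamma (m - ν)),
    by positivity, fun v w hw hv hvw => ?_⟩
  have hvn : 0 < ‖v‖ := norm_pos_iff.2 hv
  have hwn : 0 < ‖w‖ := norm_pos_iff.2 hw
  have h8 : 0 < ‖v‖ ^ 2 / 8 := by positivity
  rw [covDiff_eq_integral hα hν, abs_mul, abs_of_nonneg (by positivity), mul_assoc, mul_assoc]
  refine mul_le_mul_of_nonneg_left ?_ (by positivity)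
  have hpow : ∀ u : ℝ, 0 < u → u ^ (-ν - 1) * u ^ m = u ^ ((m : ℝ) - ν - 1) := fun u hu => by
    rw [← Real.rpow_natCast, ← Real.rpow_add hu]; ring_nf
  have hdom : IntegrableOn (fun u : ℝ => C * (‖w‖ ^ 2) ^ m *
      (u ^ ((m : ℝ) - ν - 1) * Real.exp (-(‖v‖ ^ 2 / 8 * u)))) (Set.Ioi 0) := by
    have := integrableOn_rpow_mul_exp_neg_mul_rpow (p := 1) (s := m - ν - 1) (b := ‖v‖ ^ 2 / 8)
      (by linarith) one_pos h8
    simp only [Real.rpow_one, neg_mul] at this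
    exact this.const_mul _
  have hle := norm_integral_le_of_norm_le hdom (f := fun u => mixDensity ν (α ^ 2 / 4) u *
        ∑ i ∈ Finset.range (m + 1), ∑ j ∈ Finset.range (m + 1),
          diffCoeff m i j * Real.exp (-(‖v + ((i : ℝ) - j) • w‖ ^ 2 * u)))
    ((ae_restrict_mem measurableSet_Ioi).mono fun u (hu : 0 < u) => by
      rw [sum_diffCoeff_mul m fun r => Real.exp (-(‖v + r • w‖ ^ 2 * u)), norm_mul, norm_mul,
        norm_pow, norm_neg, norm_one, one_pow, one_mul,
        Real.norm_of_nonneg (mixDensity_nonneg _ _ hu), Real.norm_eq_abs]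
      calc _ ≤ u ^ (-ν - 1) * (C * (u * ‖w‖ ^ 2) ^ m * Real.exp (-(‖v‖ ^ 2 / 8 * u))) :=
            mul_le_mul (mixDensity_le_rpow ν (by positivity) hu) (h v w u hu hw hvw)
              (abs_nonneg _) (by positivity)
        _ = _ := by rw [← hpow u hu, mul_pow]; ring)
  refine hle.trans_eq ?_
  rw [integral_const_mul, Real.integral_rpow_mul_exp_neg_mul_Ioi (sub_pos.2 hm) h8]
  have e1 : (1 / (‖v‖ ^ 2 / 8)) ^ ((m : ℝ) - ν) = 8 ^ ((m : ℝ) - ν) * ‖v‖ ^ (2 * (ν - m)) := by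
    rw [one_div_div, Real.div_rpow (by norm_num) (by positivity), div_eq_mul_inv,
      ← Real.rpow_neg (by positivity), ← Real.rpow_natCast, ← Real.rpow_mul hvn.le]
    congr 2
    push_cast
    ring
  have e2 : (‖w‖ ^ 2) ^ m = ‖w‖ ^ (2 * ν) * (‖w‖ ^ (2 * (ν - m)))⁻¹ := by
    rw [← Real.rpow_neg hwn.le, ← Real.rpow_add hwn, ← pow_mul, ← Real.rpow_natCast]
    congr 1
    push_cast
    ring
  rw [e1, e2, Real.div_rpow hvn.le hwn.le]
  ring

end

/-- The lag-zero case of the mixture limit with `r n = (‖w‖/n)²` and exponents `(i-j)²`; the factors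
`Γ(ν)` and `4^ν` cancel against those of the mixture. -/
theorem tendsto_covDiff_zero {E : Type*} [NormedAddCommGroup E] [InnerProductSpace ℝ E]
    {σ α ν : ℝ} (hα : 0 < α) (hν : 0 < ν) {m : ℕ} (hm : ν < m) {w : E} (hw : w ≠ 0) :
    Tendsto (fun n : ℕ => (n : ℝ) ^ (2 * ν) * covDiff σ α ν m 0 ((1 / (n : ℝ)) • w)) atTop
      (𝓝 (σ ^ 2 * α ^ (2 * ν) * ‖w‖ ^ (2 * ν) * ∑ i ∈ Finset.range (m + 1),
        ∑ j ∈ Finset.range (m + 1), diffCoeff m i j * irregularTerm ν |(i : ℝ) - j|)) := by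
  have hwn : 0 < ‖w‖ := norm_pos_iff.2 hw
  have hΓ := Real.Gamma_pos_of_pos hν
  set s := Finset.range (m + 1) ×ˢ Finset.range (m + 1)
  set c : ℕ × ℕ → ℝ := fun p => diffCoeff m p.1 p.2
  set l : ℕ × ℕ → ℝ := fun p => ((p.1 : ℝ) - p.2) ^ 2
  set r : ℕ → ℝ := fun n => (‖w‖ / n) ^ 2
  have hl : ∀ p ∈ s, 0 ≤ l p := fun p _ => sq_nonneg _
  have hc : ∀ p < m, ∑ i ∈ s, c i * l i ^ p = 0 := fun p hp => by
    rw [Finset.sum_product]; exact sum_diffCoeff_mul_sq_pow hp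
  have hr : ∀ᶠ n in atTop, 0 < r n := by
    filter_upwards [eventually_gt_atTop 0] with n hn
    positivity
  have hr0 : Tendsto r atTop (𝓝 0) := by
    simpa using (tendsto_const_div_atTop_nhds_zero_nat ‖w‖).pow 2
  have key := (tendsto_integral_mixDensity_mul_expSum hν (show 0 < α ^ 2 / 4 by positivity) hm s c l
    hl hc hr hr0).const_mul (σ ^ 2 * (α ^ 2 / 4) ^ ν / Real.Gamma ν * ‖w‖ ^ (2 * ν))
  rw [integral_rpow_mul_expSum_eq_irregularTerm hν hm s c l hl hc] at key
  have h4 : (α ^ 2 / 4) ^ ν = α ^ (2 * ν) / 4 ^ ν := by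
    rw [Real.div_rpow (by positivity) (by norm_num), Real.rpow_mul hα.le, Real.rpow_two]
  convert key.congr' ?_ using 2
  · rw [Finset.sum_product, h4]
    simp only [l, c, Real.sqrt_sq_eq_abs]
    field_simp
  · filter_upwards [eventually_gt_atTop 0] with n hn
    have hn' : (0 : ℝ) < n := by exact_mod_cast hn
    rw [covDiff_eq_integral hα hν]
    have e1 : ∀ u, expSum s c l (r n * u) = ∑ i ∈ Finset.range (m + 1),
        ∑ j ∈ Finset.range (m + 1), diffCoeff m i j *
          Real.exp (-(‖(0 : E) + ((i : ℝ) - j) • (1 / (n : ℝ)) • w‖ ^ 2 * u)) := fun u => by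
      rw [expSum, Finset.sum_product]
      refine Finset.sum_congr rfl fun i _ => Finset.sum_congr rfl fun j _ => ?_
      rw [zero_add, smul_smul, norm_smul, mul_pow, Real.norm_eq_abs, sq_abs]
      simp only [c, l, r]
      congr 3
      field_simp
    have e2 : r n ^ (-ν) * ‖w‖ ^ (2 * ν) = (n : ℝ) ^ (2 * ν) := by
      simp only [r]
      rw [← Real.rpow_natCast, ← Real.rpow_mul (by positivity), Real.div_rpow hwn.le hn'.le,
        show ((2 : ℕ) : ℝ) * -ν = -(2 * ν) by push_cast; ring, Real.rpow_neg hwn.le,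
        Real.rpow_neg hn'.le]
      have : 0 < ‖w‖ ^ (2 * ν) := by positivity
      field_simp
    simp_rw [e1]
    rw [← e2]
    ring

/-! ### Gaussian quadratic forms: variance and exponential concentration -/

section

lemma gaussianReal_zero_eq_map {v : ℝ} (hv : 0 ≤ v) :
    gaussianReal 0 v.toNNReal = (gaussianReal 0 1).map (√v * ·) := by
  rw [gaussianReal_map_const_mul, mul_zero, mul_one]
  congr 1
  ext
  simp [Real.sq_sqrt hv, hv]

/-- No bound on `y` is needed: for `y ≥ 1/2` the integral is undefined and equals `0` by convention,
as does the right-hand side. -/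
lemma integral_exp_mul_sq_gaussianReal {y : ℝ} :
    ∫ x, Real.exp (y * x ^ 2) ∂gaussianReal 0 1 = (√(1 - 2 * y))⁻¹ := by
  rw [integral_gaussianReal_eq_integral_smul one_ne_zero]
  have e : ∀ x : ℝ, gaussianPDFReal 0 1 x • Real.exp (y * x ^ 2) =
      (√(2 * Real.pi))⁻¹ * Real.exp (-(1 / 2 - y) * x ^ 2) := fun x => by
    rw [gaussianPDFReal, smul_eq_mul, mul_assoc, ← Real.exp_add]
    simp only [NNReal.coe_one, mul_one, sub_zero]
    ring_nf
  simp_rw [e]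
  rw [integral_const_mul, integral_gaussian, ← Real.sqrt_inv, ← Real.sqrt_mul (by positivity),
    ← Real.sqrt_inv]
  congr 1
  have := Real.pi_pos
  rw [show 1 - 2 * y = 2 * (1 / 2 - y) by ring, mul_inv, mul_inv]
  field_simp

lemma exp_neg_sub_sq_le {z : ℝ} (hz : |z| ≤ 1 / 2) : Real.exp (-z - z ^ 2) ≤ 1 - z := by
  obtain ⟨h1, h2⟩ := abs_le.1 hz
  have hpos : 0 < 1 - z := by linarith
  rw [show -z - z ^ 2 = -(z + z ^ 2) by ring, Real.exp_neg]
  refine inv_le_of_inv_le₀ hpos ?_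
  rw [inv_eq_one_div, div_le_iff₀ hpos]
  rcases le_total 0 z with h | h
  · have := Real.quadratic_le_exp_of_nonneg (show 0 ≤ z + z ^ 2 by positivity)
    nlinarith [mul_le_mul_of_nonneg_right this hpos.le, mul_nonneg (mul_nonneg (sq_nonneg z)
      (show 0 ≤ 1 - 2 * z by linarith)) (show 0 ≤ 1 + z by linarith), pow_nonneg h 3,
      mul_nonneg (pow_nonneg h 4) hpos.le]
  · have := Real.add_one_le_exp (z + z ^ 2)
    nlinarith [mul_le_mul_of_nonneg_right this hpos.le, mul_nonneg (sq_nonneg z) (neg_nonneg.2 h)]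

/-- A sub-Gaussian bound for the centred chi-square moment generating function near `0`, obtained
from `log (1 - z) ≥ -z - z²` at `z = 2y`. -/
lemma inv_sqrt_mul_exp_neg_le {y : ℝ} (hy : |y| ≤ 1 / 4) :
    (√(1 - 2 * y))⁻¹ * Real.exp (-y) ≤ Real.exp (2 * y ^ 2) := by
  obtain ⟨h1, h2⟩ := abs_le.1 hy
  have hpos : 0 < √(1 - 2 * y) := Real.sqrt_pos.2 (by linarith)
  rw [inv_mul_le_iff₀ hpos]
  have h3 : Real.exp (-y - 2 * y ^ 2) ≤ √(1 - 2 * y) := by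
    refine Real.le_sqrt_of_sq_le ?_
    rw [← Real.exp_nat_mul]
    refine le_trans (le_of_eq ?_) (exp_neg_sub_sq_le (z := 2 * y) (by rw [abs_mul, abs_two]; linarith))
    congr 1
    push_cast
    ring
  calc Real.exp (-y) = Real.exp (-y - 2 * y ^ 2) * Real.exp (2 * y ^ 2) := by
        rw [← Real.exp_add]; ring_nf
    _ ≤ _ := by gcongr

variable {S : Type*} [MeasurableSpace S] {P : Measure S}

section OneDim

variable {W : S → ℝ} {v : ℝ}

lemma mgf_sq_sub_of_gaussian (hv : 0 ≤ v) (hW : AEMeasurable W P)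
    (hlaw : P.map W = gaussianReal 0 v.toNNReal) (t : ℝ) :
    mgf (fun ω => W ω ^ 2 - v) P t = (√(1 - 2 * (t * v)))⁻¹ * Real.exp (-(t * v)) := by
  have e : ∀ ω, Real.exp (t * (W ω ^ 2 - v)) =
      (fun x => Real.exp (t * x ^ 2) * Real.exp (-(t * v))) (W ω) := fun ω => by
    simp only [← Real.exp_add]; ring_nf
  simp_rw [mgf, e]
  rw [← integral_map (φ := W) (f := fun x => Real.exp (t * x ^ 2) * Real.exp (-(t * v))) hW
    (Measurable.aestronglyMeasurable (by fun_prop)), hlaw, gaussianReal_zero_eq_map hv, integral_map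
    (by fun_prop) (Measurable.aestronglyMeasurable (by fun_prop)), integral_mul_const]
  congr 1
  rw [← integral_exp_mul_sq_gaussianReal]
  simp only [mul_pow, Real.sq_sqrt hv, mul_assoc]

lemma memLp_sq_of_gaussian (hW : AEMeasurable W P)
    (hlaw : P.map W = gaussianReal 0 v.toNNReal) : MemLp (fun ω => W ω ^ 2) 2 P := by
  have h1 : MemLp (fun x : ℝ => x ^ 2) 2 (gaussianReal 0 v.toNNReal) := by
    have := (memLp_id_gaussianReal' (μ := 0) (v := v.toNNReal) 4 (by norm_num))
    have h2 := this.norm_rpow_div (2 : ENNReal)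
    have e4 : (4 : ENNReal) / 2 = 2 := by
      rw [show (4 : ENNReal) = 2 * 2 by norm_num]
      exact ENNReal.mul_div_cancel_right (by norm_num) (by norm_num)
    rw [e4] at h2
    simpa using h2
  rw [← hlaw] at h1
  exact h1.comp_of_map hW

lemma variance_sq_of_gaussian (hv : 0 ≤ v) (hW : AEMeasurable W P)
    (hlaw : P.map W = gaussianReal 0 v.toNNReal) :
    Var[fun ω => W ω ^ 2; P] = v ^ 2 * Var[fun x => x ^ 2; gaussianReal 0 1] := by
  have h1 : Var[fun x : ℝ => x ^ 2; P.map W] = Var[fun ω => W ω ^ 2; P] :=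
    variance_map (by fun_prop) hW
  rw [← h1, hlaw, gaussianReal_zero_eq_map hv, variance_map (by fun_prop) (by fun_prop),
    ← variance_const_mul]
  congr 1
  ext x
  simp [mul_pow, Real.sq_sqrt hv]

lemma integral_sq_of_gaussian (hv : 0 ≤ v) (hW : AEMeasurable W P)
    (hlaw : P.map W = gaussianReal 0 v.toNNReal) : ∫ ω, W ω ^ 2 ∂P = v := by
  have h1 := variance_id_gaussianReal (μ := 0) (v := v.toNNReal)
  rw [variance_eq_integral (by fun_prop)] at h1
  simp only [id_eq, integral_id_gaussianReal, sub_zero] at h1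
  rw [← integral_map (φ := W) (f := fun x => x ^ 2) hW
    (Measurable.aestronglyMeasurable (by fun_prop)), hlaw, h1]
  simp [hv]

end OneDim

variable {ι : Type*} [Fintype ι]

/-- A Gaussian quadratic form is a sum of squares of independent Gaussian variables. -/
theorem exists_iIndepFun_sum_sq_eq {X : ι → S → ℝ} (hX : HasGaussianLaw (fun ω => (X · ω)) P)
    (h0 : ∀ i, ∫ ω, X i ω ∂P = 0) :
    ∃ (v : ι → ℝ) (W : ι → S → ℝ), iIndepFun W P ∧ (∀ k, 0 ≤ v k) ∧ (∀ k, AEMeasurable (W k) P) ∧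
      (∀ k, P.map (W k) = gaussianReal 0 (v k).toNNReal) ∧
      (∀ ω, ∑ k, W k ω ^ 2 = ∑ i, X i ω ^ 2) ∧
      ∑ k, v k ^ 2 = ∑ i, ∑ j, cov[X i, X j; P] ^ 2 := by
  classical
  have hXi : ∀ i, MemLp (X i) 2 P := fun i => (hX.eval i).memLp_two
  -- Coordinates in an eigenbasis of the covariance matrix are uncorrelated and jointly Gaussian,
  -- hence independent; orthonormality preserves the sum of squares.
  set C : Matrix ι ι ℝ := Matrix.of fun i j => cov[X i, X j; P]
  have hC : C.IsHermitian := by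
    ext i j
    simp [C, covariance_comm (X i) (X j)]
  set b := hC.eigenvectorBasis
  set v := hC.eigenvalues
  have hbv : ∀ k i, ∑ j, cov[X i, X j; P] * b k j = v k * b k i := fun k i => by
    have := congrFun (hC.mulVec_eigenvectorBasis k) i
    simpa [Matrix.mulVec, dotProduct, C] using this
  set W : ι → S → ℝ := fun k ω => ∑ i, b k i * X i ω
  have hW : HasGaussianLaw (fun ω => (W · ω)) P := by
    let L : (ι → ℝ) →L[ℝ] (ι → ℝ) :=
      ContinuousLinearMap.pi fun k => ∑ i, b k i • ContinuousLinearMap.proj i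
    have e : (fun ω => (W · ω)) = fun ω => L (X · ω) := by
      ext ω k
      simp [L, W]
    rw [e]
    exact hX.map_fun L
  have horth : ∀ k l, ∑ i, b k i * b l i = if k = l then 1 else 0 := fun k l => by
    have := orthonormal_iff_ite.1 b.orthonormal l k
    simp only [PiLp.inner_apply, RCLike.inner_apply, conj_trivial, eq_comm (a := l)] at this
    exact this
  have hcov : ∀ k l, cov[W k, W l; P] = if k = l then v l else 0 := fun k l => by
    have hm : ∀ k i, MemLp (fun ω => b k i * X i ω) 2 P := fun k i => (hXi i).const_mul _
    have e1 : cov[W k, W l; P] =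
        ∑ i, ∑ j, cov[fun ω => b k i * X i ω, fun ω => b l j * X j ω; P] := by
      have := hX.isProbabilityMeasure
      exact covariance_fun_sum_fun_sum (hm k) (hm l)
    simp_rw [e1, covariance_const_mul_left, covariance_const_mul_right]
    have e2 : ∀ i, ∑ j, b k i * (b l j * cov[X i, X j; P]) = v l * (b k i * b l i) := fun i => by
      rw [mul_left_comm, ← hbv, Finset.mul_sum]
      exact Finset.sum_congr rfl fun j _ => by ring
    simp_rw [e2]
    rw [← Finset.mul_sum, horth]
    simp
  have hWm : ∀ k, AEMeasurable (W k) P := fun k => (hW.eval k).aemeasurable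
  have hvar : ∀ k, Var[W k; P] = v k := fun k => by
    rw [← covariance_self (hWm k), hcov, if_pos rfl]
  have hmean : ∀ k, ∫ ω, W k ω ∂P = 0 := fun k => by
    have := hX.isProbabilityMeasure
    rw [integral_finsetSum _ fun i _ => ((hXi i).integrable (by norm_num)).const_mul _]
    exact Finset.sum_eq_zero fun i _ => by rw [integral_const_mul, h0, mul_zero]
  refine ⟨v, W, hW.iIndepFun_of_covariance_eq_zero fun i j hij => by rw [hcov, if_neg hij],
    fun k => hvar k ▸ variance_nonneg _ _, hWm, fun k => ?_, fun ω => ?_, ?_⟩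
  · rw [(hW.eval k).map_eq_gaussianReal, hmean, hvar]
  · have := b.sum_sq_norm_inner_right (WithLp.toLp 2 (X · ω))
    rw [EuclideanSpace.norm_sq_eq] at this
    simpa [PiLp.inner_apply, W, mul_comm] using this
  -- Both sides are the squared Frobenius norm: `v k ^ 2` is the squared norm of `C b_k`, and
  -- Parseval is applied to each row of `C`.
  · have e1 : ∀ k, v k ^ 2 = ∑ i, (v k * b k i) ^ 2 := fun k => by
      simp_rw [mul_pow]
      rw [← Finset.mul_sum]
      have := horth k k
      simp only [if_true, ← pow_two] at this
      rw [this, mul_one]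
    simp_rw [e1, ← hbv]
    rw [Finset.sum_comm]
    refine Finset.sum_congr rfl fun i _ => ?_
    have := b.sum_sq_norm_inner_right (WithLp.toLp 2 fun j => cov[X i, X j; P])
    rw [EuclideanSpace.norm_sq_eq] at this
    simpa [PiLp.inner_apply, mul_comm] using this

variable {X : ι → S → ℝ}

theorem memLp_sum_sq_and_variance (hX : HasGaussianLaw (fun ω => (X · ω)) P)
    (h0 : ∀ i, ∫ ω, X i ω ∂P = 0) :
    MemLp (fun ω => ∑ i, X i ω ^ 2) 2 P ∧
    Var[fun ω => ∑ i, X i ω ^ 2; P] =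
      Var[fun x => x ^ 2; gaussianReal 0 1] * ∑ i, ∑ j, cov[X i, X j; P] ^ 2 := by
  obtain ⟨v, W, hind, hv, hWm, hlaw, hsum, hsq⟩ := exists_iIndepFun_sum_sq_eq hX h0
  have hm : ∀ k, MemLp (fun ω => W k ω ^ 2) 2 P := fun k =>
    memLp_sq_of_gaussian (hWm k) (hlaw k)
  simp_rw [← hsum, ← hsq]
  refine ⟨memLp_finsetSum _ fun k _ => hm k, ?_⟩
  have := IndepFun.variance_sum (μ := P) (X := fun k ω => W k ω ^ 2) (s := Finset.univ)
    (fun k _ => hm k) (fun i _ j _ hij =>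
      (hind.indepFun hij).comp (φ := fun x => x ^ 2) (ψ := fun x => x ^ 2) (by fun_prop)
        (by fun_prop))
  have e : (∑ k, fun ω => W k ω ^ 2) = fun ω => ∑ k, W k ω ^ 2 := by ext; simp
  rw [e] at this
  rw [this, Finset.mul_sum]
  exact Finset.sum_congr rfl fun k _ => by
    rw [variance_sq_of_gaussian (hv k) (hWm k) (hlaw k), mul_comm]

/-- Exponential concentration of Gaussian quadratic forms. -/
theorem measureReal_abs_sum_sq_sub_ge_le (hX : HasGaussianLaw (fun ω => (X · ω)) P)
    (h0 : ∀ i, ∫ ω, X i ω ∂P = 0) {Λ : ℝ} (hΛ : 0 < Λ)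
    (hcov : ∑ i, ∑ j, cov[X i, X j; P] ^ 2 ≤ Λ ^ 2) (ε : ℝ) :
    P.real {ω | ε ≤ |∑ i, X i ω ^ 2 - ∑ i, cov[X i, X i; P]|} ≤
      2 * Real.exp (1 / 8 - ε / (4 * Λ)) := by
  have := hX.isProbabilityMeasure
  obtain ⟨v, W, hind, hv, hWm, hlaw, hsum, hsq⟩ := exists_iIndepFun_sum_sq_eq hX h0
  have hm : ∀ k, MemLp (fun ω => W k ω ^ 2) 2 P := fun k =>
    memLp_sq_of_gaussian (hWm k) (hlaw k)
  have hXi : ∀ i, MemLp (X i) 2 P := fun i => (hX.eval i).memLp_two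
  have htr : ∑ i, cov[X i, X i; P] = ∑ k, v k := by
    have h1 : ∫ ω, ∑ k, W k ω ^ 2 ∂P = ∑ k, v k := by
      rw [integral_finsetSum _ fun k _ => (hm k).integrable (by norm_num)]
      exact Finset.sum_congr rfl fun k _ => integral_sq_of_gaussian (hv k) (hWm k) (hlaw k)
    rw [← h1]
    simp_rw [hsum]
    rw [integral_finsetSum _ fun i _ => (hXi i).integrable_sq]
    refine Finset.sum_congr rfl fun i _ => ?_
    rw [covariance_self (hXi i).aemeasurable, variance_of_integral_eq_zero (hXi i).aemeasurable (h0 i)]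
  set Z : ι → S → ℝ := fun k ω => W k ω ^ 2 - v k
  have hZ : ∀ ω, ∑ i, X i ω ^ 2 - ∑ i, cov[X i, X i; P] = (∑ k, Z k) ω := fun ω => by
    simp [Z, htr, hsum]
  have hZm : ∀ k, AEMeasurable (Z k) P := fun k => ((hWm k).pow_const 2).sub_const _
  have hZind : iIndepFun Z P :=
    hind.comp (fun k x => x ^ 2 - v k) fun k => by fun_prop
  have hvΛ : ∀ k, v k ≤ Λ := fun k => by
    refine le_of_sq_le_sq ?_ hΛ.le
    calc v k ^ 2 ≤ ∑ k, v k ^ 2 :=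
          Finset.single_le_sum (f := fun k => v k ^ 2) (fun _ _ => sq_nonneg _) (Finset.mem_univ k)
      _ ≤ Λ ^ 2 := hsq ▸ hcov
  -- This size of `t` gives `|t v k| ≤ 1/4`, and total exponent `2 t² ∑ v k ^ 2 ≤ 1/8`.
  have hmgf : ∀ t, |t| = 1 / (4 * Λ) →
      mgf (∑ k, Z k) P t ≤ Real.exp (1 / 8) ∧
      Integrable (fun ω => Real.exp (t * (∑ k, Z k) ω)) P := fun t ht => by
    have htv : ∀ k, |t * v k| ≤ 1 / 4 := fun k => by
      rw [abs_mul, ht, abs_of_nonneg (hv k), div_mul_eq_mul_div, one_mul, div_le_iff₀ (by positivity)]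
      linarith [hvΛ k]
    have ht2 : t ^ 2 * Λ ^ 2 = 1 / 16 := by
      rw [← sq_abs, ht]; field_simp; norm_num
    have hprod := hZind.mgf_sum₀ (t := t) hZm Finset.univ
    have hk : ∀ k, mgf (Z k) P t = (√(1 - 2 * (t * v k)))⁻¹ * Real.exp (-(t * v k)) := fun k =>
      mgf_sq_sub_of_gaussian (hv k) (hWm k) (hlaw k) t
    have hpos : ∀ k, 0 < mgf (Z k) P t := fun k => by
      have := (abs_le.1 (htv k)).2
      have : 0 < √(1 - 2 * (t * v k)) := Real.sqrt_pos.2 (by linarith)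
      rw [hk]; positivity
    constructor
    · rw [hprod]
      calc ∏ k, mgf (Z k) P t ≤ ∏ k, Real.exp (2 * (t * v k) ^ 2) :=
            Finset.prod_le_prod (fun k _ => (hpos k).le) fun k _ => by
              rw [hk]; exact inv_sqrt_mul_exp_neg_le (htv k)
        _ = Real.exp (2 * t ^ 2 * ∑ k, v k ^ 2) := by
            rw [← Real.exp_sum, Finset.mul_sum]
            congr 1
            exact Finset.sum_congr rfl fun k _ => by ring
        _ ≤ _ := by
            have h1 : ∑ k, v k ^ 2 ≤ Λ ^ 2 := hsq ▸ hcov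
            have h2 : t ^ 2 * ∑ k, v k ^ 2 ≤ t ^ 2 * Λ ^ 2 := by gcongr
            refine Real.exp_le_exp.2 ?_
            linarith
    -- A non-integrable exponential would make the moment generating function `0` by convention, yet
    -- it is a product of positive factors.
    · by_contra hcon
      have : mgf (∑ k, Z k) P t = 0 := integral_undef hcon
      rw [hprod] at this
      exact (Finset.prod_pos fun k _ => hpos k).ne' this
  have hset : {ω | ε ≤ |∑ i, X i ω ^ 2 - ∑ i, cov[X i, X i; P]|} ⊆
      {ω | ε ≤ (∑ k, Z k) ω} ∪ {ω | (∑ k, Z k) ω ≤ -ε} := fun ω hω => by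
    simp only [Set.mem_ofPred_eq, hZ] at hω
    rcases le_abs'.1 hω with h | h
    · exact Or.inr h
    · exact Or.inl h
  have hu := hmgf (1 / (4 * Λ)) (abs_of_pos (by positivity))
  have hl := hmgf (-(1 / (4 * Λ))) (by rw [abs_neg, abs_of_pos (by positivity)])
  have h1 := measure_ge_le_exp_mul_mgf (μ := P) ε (show 0 ≤ 1 / (4 * Λ) by positivity) hu.2
  have h2 := measure_le_le_exp_mul_mgf (μ := P) (-ε) (show -(1 / (4 * Λ)) ≤ 0 by
    have : 0 < 1 / (4 * Λ) := by positivity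
    linarith) hl.2
  calc _ ≤ P.real ({ω | ε ≤ (∑ k, Z k) ω} ∪ {ω | (∑ k, Z k) ω ≤ -ε}) := measureReal_mono hset
    _ ≤ _ := measureReal_union_le _ _
    _ ≤ Real.exp (-(1 / (4 * Λ)) * ε) * Real.exp (1 / 8) +
        Real.exp (-(-(1 / (4 * Λ))) * -ε) * Real.exp (1 / 8) := by
      refine add_le_add (h1.trans ?_) (h2.trans ?_)
      · gcongr; exact hu.1
      · gcongr; exact hl.1
    _ = _ := by
      rw [← Real.exp_add, ← Real.exp_add, two_mul]
      congr 2 <;> ring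

end

/-! ### Partial sums of powers -/

section PowerSums

/-- For `p ≤ 1` Bernoulli's inequality for concave powers drives a telescoping induction; for `p ≥
1` every term is at most `L^(p-1)`. -/
lemma sum_rpow_sub_one_le {p : ℝ} (hp : 0 < p) :
    ∃ C, 0 < C ∧ ∀ L : ℕ, ∑ r ∈ Finset.range L, ((r : ℝ) + 1) ^ (p - 1) ≤ C * (L : ℝ) ^ p := by
  rcases le_total p 1 with h1 | h1
  · refine ⟨1 / p, by positivity, fun L => ?_⟩
    induction L with
    | zero => simp [Real.zero_rpow hp.ne']
    | succ L ih =>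
      rw [Finset.sum_range_succ]
      have hL : (0 : ℝ) < L + 1 := by positivity
      have hB := rpow_one_add_le_one_add_mul_self (s := -1 / ((L : ℝ) + 1)) (p := p)
        (by rw [le_div_iff₀ hL]; have : (0 : ℝ) ≤ L := by positivity
            linarith) hp.le h1
      have e : 1 + -1 / ((L : ℝ) + 1) = L / (L + 1) := by field_simp; ring
      rw [e, Real.div_rpow (by positivity) hL.le, div_le_iff₀ (by positivity)] at hB
      have e2 : ((L : ℝ) + 1) ^ (p - 1) = ((L : ℝ) + 1) ^ p / (L + 1) := Real.rpow_sub_one hL.ne' p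
      have e3 : (1 + p * (-1 / ((L : ℝ) + 1))) * ((L : ℝ) + 1) ^ p =
          ((L : ℝ) + 1) ^ p - p * (((L : ℝ) + 1) ^ p / (L + 1)) := by field_simp; ring
      rw [e3] at hB
      push_cast
      rw [e2]
      calc _ ≤ 1 / p * (L : ℝ) ^ p + ((L : ℝ) + 1) ^ p / (L + 1) := by linarith
        _ = 1 / p * ((L : ℝ) ^ p + p * (((L : ℝ) + 1) ^ p / (L + 1))) := by field_simp
        _ ≤ _ := by gcongr; linarith
  · refine ⟨1, one_pos, fun L => ?_⟩
    rcases Nat.eq_zero_or_pos L with rfl | hL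
    · simp [Real.zero_rpow hp.ne']
    have hL' : (0 : ℝ) < L := by exact_mod_cast hL
    calc _ ≤ ∑ r ∈ Finset.range L, (L : ℝ) ^ (p - 1) := by
          refine Finset.sum_le_sum fun r hr => ?_
          have : ((r + 1 : ℕ) : ℝ) ≤ L := by exact_mod_cast Finset.mem_range.1 hr
          push_cast at this
          exact Real.rpow_le_rpow (by positivity) this (by linarith)
      _ = _ := by
          rw [Finset.sum_const, Finset.card_range, nsmul_eq_mul, Real.rpow_sub_one hL'.ne']
          field_simp

lemma sum_rpow_neg_one_le (L : ℕ) :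
    ∑ r ∈ Finset.range L, ((r : ℝ) + 1) ^ (-1 : ℝ) ≤ 1 + Real.log L := by
  have h := harmonic_le_one_add_log L
  rw [harmonic] at h
  push_cast at h
  simpa [Real.rpow_neg_one] using h

lemma sum_rpow_le_of_lt {s : ℝ} (hs : s < -1) :
    ∃ C, 0 < C ∧ ∀ L : ℕ, ∑ r ∈ Finset.range L, ((r : ℝ) + 1) ^ s ≤ C := by
  have h1 : Summable fun r : ℕ => ((r : ℝ) + 1) ^ s := by
    have := (summable_nat_add_iff 1).2 (Real.summable_nat_rpow.2 hs)
    simpa using this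
  refine ⟨∑' r : ℕ, ((r : ℝ) + 1) ^ s + 1, ?_, fun L => ?_⟩
  · have : 0 ≤ ∑' r : ℕ, ((r : ℝ) + 1) ^ s := tsum_nonneg fun r => by positivity
    linarith
  · have := h1.sum_le_tsum (Finset.range L) fun r _ => by positivity
    linarith

end PowerSums

/-! ### Lattice boxes, shells and the cardinality of the grid -/

section Lattice

variable {d : ℕ}

/-- The box `[-r, r]^d` in `ℤ^d`. -/
def latticeBox (d r : ℕ) : Finset (Fin d → ℤ) := Finset.Icc (fun _ => -(r : ℤ)) fun _ => (r : ℤ)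

lemma mem_latticeBox {r : ℕ} {k : Fin d → ℤ} : k ∈ latticeBox d r ↔ ∀ i, |k i| ≤ r := by
  simp [latticeBox, Finset.mem_Icc, Pi.le_def, abs_le, forall_and]

lemma card_latticeBox (d r : ℕ) : (latticeBox d r).card = (2 * r + 1) ^ d := by
  rw [latticeBox, Pi.card_Icc]
  simp only [Int.card_Icc, Finset.prod_const, Finset.card_univ, Fintype.card_fin]
  congr 1
  omega

lemma latticeBox_mono {r s : ℕ} (h : r ≤ s) : latticeBox d r ⊆ latticeBox d s := fun k hk =>
  mem_latticeBox.2 fun i => (mem_latticeBox.1 hk i).trans (by exact_mod_cast h)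

/-- Bernoulli's inequality at `-2/(x+2)`; with `x = 2L + 1` it counts the shell between consecutive
boxes. -/
lemma add_two_pow_sub_pow_le (x : ℝ) (hx : 0 ≤ x) (d : ℕ) :
    (x + 2) ^ d - x ^ d ≤ 2 * d * (x + 2) ^ (d - 1) := by
  rcases d with _ | d
  · simp
  have h := one_add_mul_le_pow (a := -2 / (x + 2)) (by rw [le_div_iff₀ (by linarith)]; linarith)
    (d + 1)
  have hx2 : 0 < x + 2 := by linarith
  have e : 1 + -2 / (x + 2) = x / (x + 2) := by field_simp; ring
  rw [e, div_pow, le_div_iff₀ (by positivity)] at h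
  have e2 : (1 + ((d + 1 : ℕ) : ℝ) * (-2 / (x + 2))) * (x + 2) ^ (d + 1) =
      (x + 2) ^ (d + 1) - 2 * ((d + 1 : ℕ) : ℝ) * (x + 2) ^ d := by
    rw [pow_succ]; field_simp; ring
  rw [e2] at h
  simp only [Nat.add_sub_cancel]
  linarith

/-- Summation over shells. -/
lemma sum_latticeBox_le (hd : 1 ≤ d) {F : (Fin d → ℤ) → ℝ} {s C : ℝ} (hC : 0 ≤ C)
    (h0 : ∀ k, F k ≤ C)
    (hF : ∀ (r : ℕ) k, k ∉ latticeBox d r → F k ≤ C * ((r : ℝ) + 1) ^ s) (L : ℕ) :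
    ∑ k ∈ latticeBox d L, F k ≤
      C * (2 * d * 3 ^ (d - 1)) * (1 + ∑ r ∈ Finset.range L, ((r : ℝ) + 1) ^ ((d : ℝ) - 1 + s)) := by
  have hd1 : (1 : ℝ) ≤ d := by exact_mod_cast hd
  induction L with
  | zero =>
    have : (latticeBox d 0).card = 1 := by simp [card_latticeBox]
    have h3 : (1 : ℝ) ≤ 3 ^ (d - 1) := one_le_pow₀ (by norm_num)
    calc _ ≤ ∑ k ∈ latticeBox d 0, C := Finset.sum_le_sum fun k _ => h0 k
      _ = C := by rw [Finset.sum_const, this, one_smul]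
      _ ≤ _ := by
        simp only [Finset.range_zero, Finset.sum_empty, add_zero, mul_one]
        exact le_mul_of_one_le_right hC (by nlinarith)
  | succ L ih =>
    rw [← Finset.sum_sdiff (latticeBox_mono (d := d) L.le_succ), Finset.sum_range_succ]
    have hL : (0 : ℝ) < L + 1 := by positivity
    have hcard : ((latticeBox d (L + 1) \ latticeBox d L).card : ℝ) ≤
        2 * d * 3 ^ (d - 1) * ((L : ℝ) + 1) ^ ((d : ℝ) - 1) := by
      have e : ((d : ℝ) - 1) = ((d - 1 : ℕ) : ℝ) := by push_cast [hd]; ring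
      rw [Finset.card_sdiff_of_subset (latticeBox_mono L.le_succ), Nat.cast_sub
        (Finset.card_le_card (latticeBox_mono L.le_succ)), card_latticeBox, card_latticeBox, e,
        Real.rpow_natCast, mul_assoc, ← mul_pow]
      push_cast
      have := add_two_pow_sub_pow_le (2 * (L : ℝ) + 1) (by positivity) d
      rw [show 2 * ((L : ℝ) + 1) + 1 = 2 * (L : ℝ) + 1 + 2 by ring]
      refine this.trans ?_
      gcongr
      linarith
    have hshell : ∑ k ∈ latticeBox d (L + 1) \ latticeBox d L, F k ≤
        C * (2 * d * 3 ^ (d - 1)) * ((L : ℝ) + 1) ^ ((d : ℝ) - 1 + s) := by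
      calc _ ≤ ∑ k ∈ latticeBox d (L + 1) \ latticeBox d L, C * ((L : ℝ) + 1) ^ s :=
            Finset.sum_le_sum fun k hk => hF L k (Finset.mem_sdiff.1 hk).2
        _ = ((latticeBox d (L + 1) \ latticeBox d L).card : ℝ) * (C * ((L : ℝ) + 1) ^ s) := by
            rw [Finset.sum_const, nsmul_eq_mul]
        _ ≤ 2 * d * 3 ^ (d - 1) * ((L : ℝ) + 1) ^ ((d : ℝ) - 1) * (C * ((L : ℝ) + 1) ^ s) := by
            gcongr
        _ = _ := by rw [Real.rpow_add hL]; ring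
    linarith

/-- The point `k / n` of `ℤ^d / n`. -/
def latticePoint (n : ℕ) (k : Fin d → ℤ) : EuclideanSpace ℝ (Fin d) :=
  WithLp.toLp 2 fun i => (k i : ℝ) / n

lemma latticePoint_injective {n : ℕ} (hn : 0 < n) :
    Function.Injective (latticePoint (d := d) n) := fun k l h => by
  ext i
  have h1 : (k i : ℝ) / n = (l i : ℝ) / n := congrFun (congrArg WithLp.ofLp h) i
  have hn' : (n : ℝ) ≠ 0 := by positivity
  field_simp at h1
  exact_mod_cast h1

lemma grid_eq_image (Ω : Set (EuclideanSpace ℝ (Fin d))) (n : ℕ) :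
    grid Ω n = latticePoint n '' {k | latticePoint n k ∈ Ω} := by
  ext t
  constructor
  · rintro ⟨ht, k, hk⟩
    have : latticePoint n k = t := by ext i; exact (hk i).symm
    exact ⟨k, by rwa [Set.mem_ofPred_eq, this], this⟩
  · rintro ⟨k, hk, rfl⟩
    exact ⟨hk, k, fun i => rfl⟩

lemma exists_subset_latticeBox {Ω : Set (EuclideanSpace ℝ (Fin d))} (hΩ : Bornology.IsBounded Ω) :
    ∃ R : ℕ, 0 < R ∧ ∀ n : ℕ, 0 < n →
      {k : Fin d → ℤ | latticePoint n k ∈ Ω} ⊆ latticeBox d (R * n) := by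
  obtain ⟨C, hC⟩ := hΩ.exists_norm_le
  refine ⟨⌈C⌉₊ + 1, Nat.succ_pos _, fun n hn k hk => mem_latticeBox.2 fun i => ?_⟩
  have hn' : (0 : ℝ) < n := by positivity
  have h1 : |(k i : ℝ) / n| ≤ (⌈C⌉₊ + 1 : ℕ) :=
    ((PiLp.norm_apply_le (latticePoint n k) i).trans (hC _ hk)).trans
      ((Nat.le_ceil C).trans (by exact_mod_cast Nat.le_succ _))
  rw [abs_div, abs_of_pos hn', div_le_iff₀ hn'] at h1
  exact_mod_cast h1

lemma exists_mul_pow_le_ncard {Ω : Set (EuclideanSpace ℝ (Fin d))} (hΩ : IsOpen Ω)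
    (hb : Bornology.IsBounded Ω) (hne : Ω.Nonempty) :
    ∃ c : ℝ, 0 < c ∧ ∀ᶠ n : ℕ in atTop,
      c * (n : ℝ) ^ d ≤ ({k : Fin d → ℤ | latticePoint n k ∈ Ω}.ncard : ℝ) := by
  obtain ⟨R, -, hR⟩ := exists_subset_latticeBox hb
  obtain ⟨x, hx⟩ := hne
  have hopen : IsOpen ((WithLp.toLp 2 : (Fin d → ℝ) → EuclideanSpace ℝ (Fin d)) ⁻¹' Ω) :=
    hΩ.preimage (PiLp.continuous_toLp 2 _)
  obtain ⟨ε, hε, hball⟩ := Metric.isOpen_iff.1 hopen x.ofLp hx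
  refine ⟨(ε / 4) ^ d, by positivity, ?_⟩
  filter_upwards [eventually_gt_atTop 0, (tendsto_natCast_atTop_atTop (R := ℝ)).eventually_ge_atTop
    (4 / ε)] with n hn hnε
  have hn' : (0 : ℝ) < n := by exact_mod_cast hn
  have hεn : 4 ≤ ε * n := by rwa [div_le_iff₀' hε] at hnε
  set N := ⌊ε / 2 * n⌋₊
  have hN : (N : ℝ) ≤ ε / 2 * n := Nat.floor_le (by positivity)
  have hN' : ε / 4 * n ≤ N := by
    have := Nat.lt_floor_add_one (ε / 2 * n)
    linarith
  -- Starting at the ceiling of `n (x i - ε/2)`, the `N` consecutive integers per coordinate stay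
  -- within `ε n / 2` of `n x i`, so all these points lie in the ball. The condition `n ≥ 4/ε`
  -- absorbs the loss of `1` in the floor defining `N`.
  let g : (Fin d → Fin N) → (Fin d → ℤ) := fun f i => ⌈n * (x i - ε / 2)⌉ + (f i : ℕ)
  have hg : Function.Injective g := fun f f' h => by
    ext i
    have := congrFun h i
    simp only [g] at this
    omega
  have hsub : Set.range g ⊆ {k : Fin d → ℤ | latticePoint n k ∈ Ω} := by
    rintro _ ⟨f, rfl⟩
    refine hball ?_
    rw [Metric.mem_ball, dist_pi_lt_iff hε]
    intro i
    have h1 := Int.le_ceil (n * (x i - ε / 2))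
    have h2 := Int.ceil_lt_add_one (n * (x i - ε / 2))
    have h3 : ((f i : ℕ) : ℝ) + 1 ≤ N := by exact_mod_cast (f i).2
    have h4 : (0 : ℝ) ≤ ((f i : ℕ) : ℝ) := by positivity
    rw [Real.dist_eq, abs_lt]
    simp only [g]
    push_cast
    constructor
    · rw [lt_sub_iff_add_lt, lt_div_iff₀ hn']
      nlinarith
    · rw [sub_lt_iff_lt_add, div_lt_iff₀ hn']
      nlinarith
  have hfin : {k : Fin d → ℤ | latticePoint n k ∈ Ω}.Finite :=
    (Finset.finite_toSet _).subset (hR n hn)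
  have hle := Set.ncard_le_ncard hsub hfin
  have hcard : (Set.range g).ncard = N ^ d := by
    rw [← Set.image_univ, Set.ncard_image_of_injective _ hg, Set.ncard_univ, Nat.card_eq_fintype_card]
    simp
  rw [hcard] at hle
  calc _ = (ε / 4 * n) ^ d := by rw [mul_pow]
    _ ≤ (N : ℝ) ^ d := by gcongr
    _ ≤ _ := by exact_mod_cast hle

end Lattice

/-! ### Increments of the field and their covariances -/

section

section Increment

variable {d : ℕ} {S : Type*}

/-- The `m`-th order increment with step `w` of the random field `Y` at `t`. -/
def increment (Y : EuclideanSpace ℝ (Fin d) → S → ℝ) (m : ℕ) (w t : EuclideanSpace ℝ (Fin d))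
    (ω : S) : ℝ :=
  (fwdDiff w)^[m] (fun t => Y t ω) t

lemma increment_eq (Y : EuclideanSpace ℝ (Fin d) → S → ℝ) (m : ℕ)
    (w t : EuclideanSpace ℝ (Fin d)) : increment Y m w t = fun ω =>
      ∑ k ∈ Finset.range (m + 1), (-1 : ℝ) ^ m * (-1) ^ k * (m.choose k : ℝ) * Y (t + k • w) ω := by
  ext ω
  rw [increment, fwdDiff_iter_eq_sum_real]

/-- The normalisation goes inside the square, so that the quadratic variation becomes a plain sum of
squares of jointly Gaussian variables. -/
lemma quadVar_eq_sum {ν : ℝ} {m : ℕ} {Y : EuclideanSpace ℝ (Fin d) → S → ℝ}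
    {Ω : Set (EuclideanSpace ℝ (Fin d))} {n : ℕ} (hn : 0 < n)
    [Fintype {k : Fin d → ℤ | latticePoint n k ∈ Ω}] (h : EuclideanSpace ℝ (Fin d)) (ω : S) :
    quadVar ν h m Ω Y n ω = ∑ k : {k : Fin d → ℤ | latticePoint n k ∈ Ω},
      (√((n : ℝ) ^ (2 * ν) / ({k : Fin d → ℤ | latticePoint n k ∈ Ω}.ncard : ℝ)) *
        increment Y m ((1 / (n : ℝ)) • h) (latticePoint n k.1) ω) ^ 2 := by
  rw [quadVar, grid_eq_image, Set.ncard_image_of_injective _ (latticePoint_injective hn),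
    finsum_mem_image (latticePoint_injective hn).injOn, ← finsum_set_coe_eq_finsum_mem,
    finsum_eq_sum_of_fintype, Finset.mul_sum]
  refine Finset.sum_congr rfl fun k _ => ?_
  rw [mul_pow, Real.sq_sqrt (by positivity), increment]
  ring

end Increment

variable {d : ℕ} {S : Type*} [MeasurableSpace S] {P : Measure S} {σ α ν : ℝ}
  {M : Matrix (Fin d) (Fin d) ℝ} {D : Set (EuclideanSpace ℝ (Fin d))}
  {Y : EuclideanSpace ℝ (Fin d) → S → ℝ}

lemma IsField.memLp (hY : IsField P σ α ν M D Y) {t : EuclideanSpace ℝ (Fin d)} (ht : t ∈ D) :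
    MemLp (Y t) 2 P :=
  (hY.gaussian.hasGaussianLaw_eval ⟨t, ht⟩).memLp_two

variable {m : ℕ} {w t t' : EuclideanSpace ℝ (Fin d)}

lemma IsField.memLp_increment (hY : IsField P σ α ν M D Y) (ht : ∀ k ≤ m, t + k • w ∈ D) :
    MemLp (increment Y m w t) 2 P := by
  rw [increment_eq]
  exact memLp_finsetSum _ fun k hk =>
    (hY.memLp (ht k (Finset.mem_range_succ_iff.1 hk))).const_mul _

lemma IsField.integral_increment [IsProbabilityMeasure P] (hY : IsField P σ α ν M D Y)
    (ht : ∀ k ≤ m, t + k • w ∈ D) : ∫ ω, increment Y m w t ω ∂P = 0 := by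
  rw [increment_eq, integral_finsetSum _ fun k hk =>
    ((hY.memLp (ht k (Finset.mem_range_succ_iff.1 hk))).integrable (by norm_num)).const_mul _]
  refine Finset.sum_eq_zero fun k hk => ?_
  rw [integral_const_mul, hY.mean_zero _ (ht k (Finset.mem_range_succ_iff.1 hk)), mul_zero]

lemma IsField.cov_increment [IsProbabilityMeasure P] (hY : IsField P σ α ν M D Y)
    (ht : ∀ k ≤ m, t + k • w ∈ D) (ht' : ∀ k ≤ m, t' + k • w ∈ D) :
    cov[increment Y m w t, increment Y m w t'; P] =
      covDiff σ α ν m (Matrix.toEuclideanLin M (t - t')) (Matrix.toEuclideanLin M w) := by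
  have hs : ∀ k ∈ Finset.range (m + 1), k ≤ m := fun k hk => Finset.mem_range_succ_iff.1 hk
  rw [increment_eq, increment_eq, covariance_fun_sum_fun_sum'
    (fun k hk => (hY.memLp (ht k (hs k hk))).const_mul _)
    (fun k hk => (hY.memLp (ht' k (hs k hk))).const_mul _), covDiff]
  refine Finset.sum_congr rfl fun i hi => Finset.sum_congr rfl fun j hj => ?_
  rw [covariance_const_mul_left, covariance_const_mul_right,
    hY.cov_eq _ (ht i (hs i hi)) _ (ht' j (hs j hj)), ← map_sub]
  have e : t + i • w - (t' + j • w) = (t - t') + ((i : ℝ) - j) • w := by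
    simp only [← Nat.cast_smul_eq_nsmul ℝ]; module
  have hm : ((-1 : ℝ) ^ m) * (-1) ^ m = 1 := by rw [← mul_pow]; norm_num
  rw [e, map_add, map_smul, diffCoeff, pow_add]
  linear_combination ((-1 : ℝ) ^ i * (-1) ^ j * (m.choose i) * (m.choose j) *
    covFun σ α ν ‖Matrix.toEuclideanLin M (t - t') +
      ((i : ℝ) - j) • Matrix.toEuclideanLin M w‖) * hm

lemma IsField.hasGaussianLaw_increment (hY : IsField P σ α ν M D Y) {ι : Type*} [Fintype ι]
    (p : ι → EuclideanSpace ℝ (Fin d)) (hp : ∀ i, ∀ k ≤ m, p i + k • w ∈ D) (c : ℝ) :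
    HasGaussianLaw (fun ω i => c * increment Y m w (p i) ω) P := by
  classical
  have h1 := (hY.gaussian.comp_right fun q : ι × Fin (m + 1) =>
    (⟨p q.1 + (q.2 : ℕ) • w, hp q.1 q.2 (by omega)⟩ : D)).hasGaussianLaw Finset.univ
  let L : (↥(Finset.univ : Finset (ι × Fin (m + 1))) → ℝ) →L[ℝ] (ι → ℝ) :=
    ContinuousLinearMap.pi fun i => c • ∑ k : Fin (m + 1),
      ((-1 : ℝ) ^ m * (-1) ^ (k : ℕ) * (m.choose k : ℝ)) •
        ContinuousLinearMap.proj (⟨(i, k), Finset.mem_univ _⟩ : ↥(Finset.univ : Finset (ι × Fin (m + 1))))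
  have e : (fun ω i => c * increment Y m w (p i) ω) = fun ω => L (Finset.univ.restrict
      (fun q : ι × Fin (m + 1) => Y (p q.1 + (q.2 : ℕ) • w) ω)) := by
    ext ω i
    rw [increment_eq]
    simp [L, Finset.sum_range]
  rw [e]
  exact h1.map_fun L

/-- Stationarity gives both increments the same variance; nonnegativity of the variances of their
sum and difference then bounds the covariance. -/
lemma IsField.abs_cov_increment_le [IsProbabilityMeasure P] (hY : IsField P σ α ν M D Y)
    (ht : ∀ k ≤ m, t + k • w ∈ D) (ht' : ∀ k ≤ m, t' + k • w ∈ D) :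
    |cov[increment Y m w t, increment Y m w t'; P]| ≤
      covDiff σ α ν m 0 (Matrix.toEuclideanLin M w) := by
  have h1 := hY.memLp_increment ht
  have h2 := hY.memLp_increment ht'
  have e1 : Var[increment Y m w t; P] = covDiff σ α ν m 0 (Matrix.toEuclideanLin M w) := by
    rw [← covariance_self h1.aemeasurable, hY.cov_increment ht ht, sub_self, map_zero]
  have e2 : Var[increment Y m w t'; P] = covDiff σ α ν m 0 (Matrix.toEuclideanLin M w) := by
    rw [← covariance_self h2.aemeasurable, hY.cov_increment ht' ht', sub_self, map_zero]
  have h3 := variance_nonneg (increment Y m w t + increment Y m w t') P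
  have h4 := variance_nonneg (increment Y m w t - increment Y m w t') P
  rw [variance_add h1 h2, e1, e2] at h3
  rw [variance_sub h1 h2, e1, e2] at h4
  exact abs_le.2 ⟨by linarith, by linarith⟩

lemma toEuclideanLin_ne_zero {h : EuclideanSpace ℝ (Fin d)} (hM : M.det = 1)
    (hh : h ≠ 0) : Matrix.toEuclideanLin M h ≠ 0 := by
  intro h0
  have h1 : M.mulVec h.ofLp = 0 := by
    have := congrArg WithLp.ofLp h0
    simpa using this
  have h2 := Matrix.eq_zero_of_mulVec_eq_zero (by rw [hM]; exact one_ne_zero) h1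
  exact hh (by ext i; exact congrFun h2 i)

/-- An injective linear map in finite dimension is bounded below, and an integer point outside the
box has a coordinate of modulus at least `r + 1`. -/
lemma exists_le_norm_toEuclideanLin_latticePoint (hM : M.det = 1) :
    ∃ c : ℝ, 0 < c ∧ ∀ (n r : ℕ), 0 < n → ∀ k : Fin d → ℤ, k ∉ latticeBox d r →
      c * ((r : ℝ) + 1) / n ≤ ‖Matrix.toEuclideanLin M (latticePoint n k)‖ := by
  have hker : LinearMap.ker (Matrix.toEuclideanLin M) = ⊥ := by
    exact LinearMap.ker_eq_bot'.2 fun x hx => by_contra fun h0 => toEuclideanLin_ne_zero hM h0 hx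
  obtain ⟨K, hK, hanti⟩ := (Matrix.toEuclideanLin M).exists_antilipschitzWith hker
  have hK' : (0 : ℝ) < K := by exact_mod_cast hK
  refine ⟨(K : ℝ)⁻¹, by positivity, fun n r hn k hk => ?_⟩
  have hn' : (0 : ℝ) < n := by positivity
  obtain ⟨i, hi⟩ : ∃ i, (r : ℤ) < |k i| := by
    simpa [mem_latticeBox] using hk
  have h1 : ((r : ℝ) + 1) / n ≤ ‖latticePoint n k‖ := by
    refine le_trans ?_ (PiLp.norm_apply_le (latticePoint n k) i)
    change _ ≤ |(k i : ℝ) / n|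
    rw [abs_div, abs_of_pos hn']
    gcongr
    exact_mod_cast hi
  have h2 := hanti.le_mul_dist (latticePoint n k) 0
  rw [map_zero, dist_zero_right, dist_zero_right] at h2
  rw [mul_div_assoc, inv_mul_le_iff₀ hK']
  exact h1.trans h2

/-- The decay of the rescaled covariances between increments at distinct lattice points. -/
lemma exists_sq_covDiff_latticePoint_le (hα : 0 < α) (hν : 0 < ν) (hM : M.det = 1) (hm : ν < m)
    {h : EuclideanSpace ℝ (Fin d)} (hh : Matrix.toEuclideanLin M h ≠ 0) :
    ∃ (r₀ : ℕ) (C : ℝ), 0 ≤ C ∧ ∀ (n r : ℕ), 0 < n → r₀ ≤ r → ∀ k : Fin d → ℤ,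
      k ∉ latticeBox d r → ((n : ℝ) ^ (2 * ν) * covDiff σ α ν m
        (Matrix.toEuclideanLin M (latticePoint n k))
        (Matrix.toEuclideanLin M ((1 / (n : ℝ)) • h))) ^ 2 ≤ C * ((r : ℝ) + 1) ^ (4 * (ν - m)) := by
  obtain ⟨C, hC, hcov⟩ := exists_abs_covDiff_le (E := EuclideanSpace ℝ (Fin d)) (σ := σ) hα hν hm
  obtain ⟨c, hc, hlow⟩ := exists_le_norm_toEuclideanLin_latticePoint hM
  have hW : 0 < ‖Matrix.toEuclideanLin M h‖ := norm_pos_iff.2 hh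
  set A := ‖Matrix.toEuclideanLin M h‖ with hA
  -- This threshold ensures `2 m ‖w‖ ≤ ‖v‖`, the separation required by the decay bound.
  refine ⟨⌈2 * m * A / c⌉₊, (C * A ^ (2 * ν) * (c / A) ^ (2 * (ν - m))) ^ 2, by positivity,
    fun n r hn hr k hk => ?_⟩
  have hn' : (0 : ℝ) < n := by positivity
  set v := Matrix.toEuclideanLin M (latticePoint n k)
  have hv : c * ((r : ℝ) + 1) / n ≤ ‖v‖ := hlow n r hn k hk
  have hv0 : 0 < ‖v‖ := lt_of_lt_of_le (by positivity) hv
  have hw : ‖Matrix.toEuclideanLin M ((1 / (n : ℝ)) • h)‖ = A / n := by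
    rw [map_smul, norm_smul, Real.norm_of_nonneg (by positivity)]; ring
  have hr' : 2 * m * A ≤ c * (r + 1) := by
    have h1 : 2 * m * A / c ≤ r := (Nat.le_ceil _).trans (by exact_mod_cast hr)
    rw [div_le_iff₀ hc] at h1
    nlinarith
  have key := hcov v (Matrix.toEuclideanLin M ((1 / (n : ℝ)) • h))
    (norm_pos_iff.1 (by rw [hw]; positivity)) (norm_pos_iff.1 hv0) (by
      rw [hw]
      refine le_trans ?_ hv
      rw [← mul_div_assoc]
      gcongr)
  rw [hw] at key
  have h1 : (‖v‖ / (A / n)) ^ (2 * (ν - m)) ≤ (c / A * ((r : ℝ) + 1)) ^ (2 * (ν - m)) := by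
    refine Real.rpow_le_rpow_of_nonpos (by positivity) ?_ (by linarith)
    rw [le_div_iff₀ (by positivity)]
    refine le_trans (le_of_eq ?_) hv
    field_simp
  have h2 : |(n : ℝ) ^ (2 * ν) * covDiff σ α ν m v
      (Matrix.toEuclideanLin M ((1 / (n : ℝ)) • h))| ≤
      C * A ^ (2 * ν) * (c / A) ^ (2 * (ν - m)) * ((r : ℝ) + 1) ^ (2 * (ν - m)) := by
    rw [abs_mul, abs_of_pos (by positivity)]
    calc _ ≤ (n : ℝ) ^ (2 * ν) * (C * (A / n) ^ (2 * ν) *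
          (c / A * ((r : ℝ) + 1)) ^ (2 * (ν - m))) := by
          gcongr
          exact key.trans (by gcongr)
      _ = _ := by
          rw [Real.mul_rpow (by positivity) (by positivity), Real.div_rpow hW.le hn'.le]
          have : 0 < (n : ℝ) ^ (2 * ν) := by positivity
          field_simp
  rw [← sq_abs]
  refine (pow_le_pow_left₀ (abs_nonneg _) h2 2).trans_eq ?_
  rw [mul_pow _ (((r : ℝ) + 1) ^ _), ← Real.rpow_natCast (((r : ℝ) + 1) ^ _),
    ← Real.rpow_mul (by positivity)]
  congr 2
  push_cast
  ring

lemma sum_sub_le_sum_latticeBox {G : Set (Fin d → ℤ)} [Fintype G] {L : ℕ}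
    (hG : G ⊆ latticeBox d L) {F : (Fin d → ℤ) → ℝ} (hF : ∀ k, 0 ≤ F k) (k : G) :
    ∑ l : G, F (k.1 - l.1) ≤ ∑ x ∈ latticeBox d (2 * L), F x := by
  classical
  have hinj : Set.InjOn (fun l : G => k.1 - l.1) (Finset.univ : Finset G) := fun a _ b _ hab =>
    Subtype.ext (sub_right_injective hab)
  rw [← Finset.sum_image (f := F) hinj]
  refine Finset.sum_le_sum_of_subset_of_nonneg (fun x hx => ?_) fun x _ _ => hF x
  obtain ⟨l, _, rfl⟩ := Finset.mem_image.1 hx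
  refine mem_latticeBox.2 fun i => ?_
  have h1 := mem_latticeBox.1 (hG k.2) i
  have h2 := mem_latticeBox.1 (hG l.2) i
  have := abs_sub (k.1 i) (l.1 i)
  push_cast
  simp only [Pi.sub_apply]
  linarith

end

/-! ### The quadratic variation as a controlled Gaussian quadratic form -/

section

variable {d : ℕ} {S : Type*} [MeasurableSpace S] {P : Measure S} [IsProbabilityMeasure P]
  {σ α ν : ℝ} {M : Matrix (Fin d) (Fin d) ℝ} {D : Set (EuclideanSpace ℝ (Fin d))}
  {Y : EuclideanSpace ℝ (Fin d) → S → ℝ} {Ω : Set (EuclideanSpace ℝ (Fin d))}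
  {h : EuclideanSpace ℝ (Fin d)} {m : ℕ}

lemma tendsto_limitCoeff (hα : 0 < α) (hν : 0 < ν) (hM : M.det = 1) (hh : h ≠ 0) (hm : ν < m) :
    Tendsto (fun n : ℕ => (n : ℝ) ^ (2 * ν) *
      covDiff σ α ν m 0 (Matrix.toEuclideanLin M ((1 / (n : ℝ)) • h))) atTop
      (𝓝 (limitCoeff σ α ν M h m)) := by
  simp_rw [map_smul]
  exact tendsto_covDiff_zero hα hν hm (toEuclideanLin_ne_zero hM hh)

/-- A uniform majorant of the rescaled squared covariances, with power decay over shells. -/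
lemma exists_majorant_sq_covDiff (hα : 0 < α) (hν : 0 < ν) (hM : M.det = 1) (hm : ν < m)
    (hh : Matrix.toEuclideanLin M h ≠ 0) (A : ℝ) :
    ∃ (C : ℝ), 0 ≤ C ∧ ∀ n : ℕ, 0 < n → ∃ F : (Fin d → ℤ) → ℝ,
      (∀ k, 0 ≤ F k) ∧ (∀ k, F k ≤ C) ∧
      (∀ (r : ℕ) k, k ∉ latticeBox d r → F k ≤ C * ((r : ℝ) + 1) ^ (4 * (ν - m))) ∧
      ∀ k, F k = A ^ 2 ∨ F k = ((n : ℝ) ^ (2 * ν) * covDiff σ α ν m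
        (Matrix.toEuclideanLin M (latticePoint n k))
        (Matrix.toEuclideanLin M ((1 / (n : ℝ)) • h))) ^ 2 := by
  classical
  obtain ⟨r₀, C, hC, hbd⟩ := exists_sq_covDiff_latticePoint_le (σ := σ) hα hν hM hm hh
  set s := 4 * (ν - m) with hs
  have hs0 : s ≤ 0 := by rw [hs]; linarith
  have hr1 : (1 : ℝ) ≤ (r₀ : ℝ) + 1 := by
    have : (0 : ℝ) ≤ r₀ := by positivity
    linarith
  have hone : (1 : ℝ) ≤ ((r₀ : ℝ) + 1) ^ (-s) := Real.one_le_rpow hr1 (by linarith)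
  -- The factor `(r₀+1)^(-s)` lets the flat value `A²` on the central box also satisfy the power
  -- bound for every `r ≤ r₀`.
  refine ⟨A ^ 2 * ((r₀ : ℝ) + 1) ^ (-s) + C, by positivity, fun n hn => ⟨fun k =>
    if k ∈ latticeBox d r₀ then A ^ 2 else ((n : ℝ) ^ (2 * ν) * covDiff σ α ν m
        (Matrix.toEuclideanLin M (latticePoint n k))
        (Matrix.toEuclideanLin M ((1 / (n : ℝ)) • h))) ^ 2, fun k => ?_, fun k => ?_,
        fun r k hk => ?_, fun k => ?_⟩⟩
  · dsimp only
    split_ifs <;> positivity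
  · dsimp only
    split_ifs with hk
    · nlinarith [sq_nonneg A]
    · calc _ ≤ C * ((r₀ : ℝ) + 1) ^ s := hbd n r₀ hn le_rfl k hk
        _ ≤ C * 1 := by gcongr; exact Real.rpow_le_one_of_one_le_of_nonpos hr1 hs0
        _ ≤ _ := by nlinarith [sq_nonneg A]
  · have hrs : 0 ≤ ((r : ℝ) + 1) ^ s := by positivity
    rw [add_mul]
    dsimp only
    split_ifs with hk'
    · have hr : r ≤ r₀ := by
        by_contra hcon
        exact hk (latticeBox_mono (not_le.1 hcon).le hk')
      have h1 : 1 ≤ ((r₀ : ℝ) + 1) ^ (-s) * ((r : ℝ) + 1) ^ s := by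
        rw [Real.rpow_neg (by positivity), inv_mul_eq_div, one_le_div (by positivity)]
        exact Real.rpow_le_rpow_of_nonpos (by positivity) (by gcongr) hs0
      nlinarith [mul_nonneg hC hrs, mul_le_mul_of_nonneg_left h1 (sq_nonneg A)]
    · have h2 : 0 ≤ A ^ 2 * ((r₀ : ℝ) + 1) ^ (-s) * ((r : ℝ) + 1) ^ s := by positivity
      rcases le_total r₀ r with hr | hr
      · linarith [hbd n r hn hr k hk]
      · have h3 := hbd n r₀ hn le_rfl k hk'
        have h4 : ((r₀ : ℝ) + 1) ^ s ≤ ((r : ℝ) + 1) ^ s :=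
          Real.rpow_le_rpow_of_nonpos (by positivity) (by gcongr) hs0
        linarith [mul_le_mul_of_nonneg_left h4 hC]
  · by_cases hk : k ∈ latticeBox d r₀ <;> simp [hk]

lemma latticePoint_sub (n : ℕ) (k l : Fin d → ℤ) :
    latticePoint n (k - l) = latticePoint n k - latticePoint n l := by
  ext i
  simp [latticePoint, sub_div]

set_option maxHeartbeats 800000 in
/-- For large `n`, the quadratic variation is a sum of squares of jointly Gaussian variables whose
covariances are controlled. -/
theorem exists_eventually_quadVar_eq_sum_sq (hY : IsField P σ α ν M D Y)
    (hΩ_open : IsOpen Ω) (hΩ_bdd : Bornology.IsBounded Ω) (hΩ_ne : Ω.Nonempty)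
    (hh : h ≠ 0) (hm : ν < m)
    (hD : ∀ᶠ n : ℕ in atTop, ∀ j ∈ grid Ω n, ∀ k ≤ m, j + ((k : ℝ) / (n : ℝ)) • h ∈ D) :
    ∃ (R : ℕ) (C : ℝ), 0 < R ∧ 0 < C ∧ ∀ᶠ n : ℕ in atTop,
      ∃ (ι : Type) (_ : Fintype ι) (X : ι → S → ℝ), HasGaussianLaw (fun ω => (X · ω)) P ∧
        (∀ i, ∫ ω, X i ω ∂P = 0) ∧ (∀ ω, quadVar ν h m Ω Y n ω = ∑ i, X i ω ^ 2) ∧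
        ∑ i, cov[X i, X i; P] = (n : ℝ) ^ (2 * ν) *
          covDiff σ α ν m 0 (Matrix.toEuclideanLin M ((1 / (n : ℝ)) • h)) ∧
        ∑ i, ∑ j, cov[X i, X j; P] ^ 2 ≤ C * (n : ℝ) ^ (-(d : ℝ)) *
          (1 + ∑ r ∈ Finset.range (R * n), ((r : ℝ) + 1) ^ ((d : ℝ) - 1 + 4 * (ν - m))) := by
  have hα := hY.alpha_pos
  have hν := hY.nu_pos
  have hM := hY.det_eq_one
  have hd : 1 ≤ d := by
    rcases d with _ | d
    · exact absurd (Subsingleton.elim h 0) hh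
    · omega
  obtain ⟨R, hR0, hR⟩ := exists_subset_latticeBox hΩ_bdd
  obtain ⟨c, hc, hN⟩ := exists_mul_pow_le_ncard hΩ_open hΩ_bdd hΩ_ne
  have hlim := tendsto_limitCoeff (σ := σ) hα hν hM hh hm
  set A := |limitCoeff σ α ν M h m| + 1
  have hA : ∀ᶠ n : ℕ in atTop, (n : ℝ) ^ (2 * ν) *
      covDiff σ α ν m 0 (Matrix.toEuclideanLin M ((1 / (n : ℝ)) • h)) ≤ A :=
    hlim.eventually_le_const (by
      have := le_abs_self (limitCoeff σ α ν M h m)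
      linarith)
  obtain ⟨C, hC, hmaj⟩ := exists_majorant_sq_covDiff (σ := σ) hα hν hM hm
    (toEuclideanLin_ne_zero hM hh) A
  -- Differences of grid indices lie in the box of radius `2Rn`; the division by `c` comes from `N ≥
  -- c n^d`, and the added `1` makes the constant positive.
  refine ⟨2 * R, (C * (2 * d * 3 ^ (d - 1)) + 1) / c, by positivity, by positivity, ?_⟩
  filter_upwards [hD, hN, hA, eventually_gt_atTop 0] with n hDn hNn hAn hn
  have hn' : (0 : ℝ) < n := by exact_mod_cast hn
  set G : Set (Fin d → ℤ) := {k | latticePoint n k ∈ Ω}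
  have hGfin : G.Finite := (Finset.finite_toSet _).subset (hR n hn)
  let _ : Fintype G := hGfin.fintype
  set w : EuclideanSpace ℝ (Fin d) := (1 / (n : ℝ)) • h with hw
  have hp : ∀ k : G, ∀ i ≤ m, latticePoint n k.1 + i • w ∈ D := fun k i hi => by
    have := hDn (latticePoint n k.1) ⟨k.2, k.1, fun _ => rfl⟩ i hi
    rwa [hw, ← Nat.cast_smul_eq_nsmul ℝ, smul_smul, mul_one_div]
  set N : ℝ := (G.ncard : ℝ)
  have hN0 : 0 < N := lt_of_lt_of_le (by positivity) hNn
  set s : ℝ := √((n : ℝ) ^ (2 * ν) / N)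
  have hs2 : s ^ 2 = (n : ℝ) ^ (2 * ν) / N := Real.sq_sqrt (by positivity)
  have hcov : ∀ k l : G, cov[fun ω => s * increment Y m w (latticePoint n k.1) ω,
      fun ω => s * increment Y m w (latticePoint n l.1) ω; P] = s ^ 2 *
      covDiff σ α ν m (Matrix.toEuclideanLin M (latticePoint n (k.1 - l.1)))
        (Matrix.toEuclideanLin M w) := fun k l => by
    rw [covariance_const_mul_left, covariance_const_mul_right, latticePoint_sub,
      hY.cov_increment (hp k) (hp l)]
    ring
  have hcard : (Fintype.card G : ℝ) = N := by
    rw [← Nat.card_eq_fintype_card]; rfl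
  obtain ⟨F, hF0, hF1, hF2, hF3⟩ := hmaj n hn
  -- Near the diagonal the covariance is controlled by the common variance, hence by `A`; elsewhere
  -- the majorant is the squared covariance itself.
  have hFcov : ∀ k l : G, ((n : ℝ) ^ (2 * ν) *
      covDiff σ α ν m (Matrix.toEuclideanLin M (latticePoint n (k.1 - l.1)))
        (Matrix.toEuclideanLin M w)) ^ 2 ≤ F (k.1 - l.1) := fun k l => by
    rcases hF3 (k.1 - l.1) with hF | hF
    · have h1 := hY.abs_cov_increment_le (hp k) (hp l)
      rw [hY.cov_increment (hp k) (hp l), ← latticePoint_sub] at h1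
      rw [hF]
      refine sq_le_sq.2 ?_
      rw [abs_mul, abs_of_pos (by positivity : (0 : ℝ) < (n : ℝ) ^ (2 * ν))]
      exact ((mul_le_mul_of_nonneg_left h1 (by positivity)).trans hAn).trans (le_abs_self A)
    · exact hF.ge
  refine ⟨G, inferInstance, fun k ω => s * increment Y m w (latticePoint n k.1) ω,
    hY.hasGaussianLaw_increment (fun k : G => latticePoint n k.1) hp s, fun k => ?_,
    fun ω => quadVar_eq_sum hn h ω, ?_, ?_⟩
  · rw [integral_const_mul, hY.integral_increment (hp k), mul_zero]
  · simp_rw [hcov, sub_self]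
    have e0 : latticePoint n (0 : Fin d → ℤ) = 0 := by ext i; simp [latticePoint]
    rw [Finset.sum_const, Finset.card_univ, nsmul_eq_mul, hcard, hs2, e0, map_zero]
    field_simp
  · set T := 1 + ∑ r ∈ Finset.range (2 * R * n), ((r : ℝ) + 1) ^ ((d : ℝ) - 1 + 4 * (ν - m))
    have hT : 0 ≤ T := by positivity
    have hbox := sum_latticeBox_le hd hC hF1 hF2 (2 * (R * n))
    rw [← mul_assoc 2 R n] at hbox
    have h1 : ∀ k : G, ∑ l : G, F (k.1 - l.1) ≤ C * (2 * d * 3 ^ (d - 1)) * T := fun k =>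
      (sum_sub_le_sum_latticeBox (hR n hn) hF0 k).trans (by rw [← mul_assoc]; exact hbox)
    calc _ ≤ ∑ k : G, ∑ l : G, (1 / N ^ 2) * F (k.1 - l.1) := by
          refine Finset.sum_le_sum fun k _ => Finset.sum_le_sum fun l _ => ?_
          rw [hcov, hs2]
          refine le_trans (le_of_eq ?_) (mul_le_mul_of_nonneg_left (hFcov k l) (by positivity))
          field_simp
      _ = (1 / N ^ 2) * ∑ k : G, ∑ l : G, F (k.1 - l.1) := by simp_rw [Finset.mul_sum]
      _ ≤ (1 / N ^ 2) * ∑ k : G, C * (2 * d * 3 ^ (d - 1)) * T := by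
          gcongr with k; exact h1 k
      _ = C * (2 * d * 3 ^ (d - 1)) * T / N := by
          rw [Finset.sum_const, Finset.card_univ, nsmul_eq_mul, hcard]; field_simp
      _ ≤ (C * (2 * d * 3 ^ (d - 1)) + 1) * T / (c * (n : ℝ) ^ d) := by
          gcongr; linarith
      _ = _ := by
          rw [Real.rpow_neg hn'.le, Real.rpow_natCast]; ring

lemma summable_exp_neg_mul_rpow {b p : ℝ} (hb : 0 < b) (hp : 0 < p) :
    Summable fun n : ℕ => Real.exp (-b * (n : ℝ) ^ p) := by
  have h1 := isLittleO_exp_neg_mul_rpow_atTop hb (-2 / p)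
  have h2 : Tendsto (fun n : ℕ => (n : ℝ) ^ p) atTop atTop :=
    (tendsto_rpow_atTop hp).comp tendsto_natCast_atTop_atTop
  have h3 := (h1.comp_tendsto h2).isBigO
  refine summable_of_isBigO_nat (Real.summable_nat_rpow.2 (show (-2 : ℝ) < -1 by norm_num)) ?_
  refine h3.congr_right fun n => ?_
  simp only [Function.comp_apply]
  rw [← Real.rpow_mul (by positivity), mul_div_cancel₀ _ hp.ne']

/-- Borel–Cantelli for each tolerance `1/(q+1)`, followed by a countable intersection. -/
lemma ae_tendsto_of_summable_tail {Q : ℕ → S → ℝ} {e : ℕ → ℝ} {a : ℝ}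
    (he : Tendsto e atTop (𝓝 a)) {f : ℝ → ℕ → ℝ} (hf : ∀ ε > 0, Summable (f ε))
    (hQ : ∀ ε > 0, ∀ᶠ n in atTop, P.real {ω | ε ≤ |Q n ω - e n|} ≤ f ε n) :
    ∀ᵐ ω ∂P, Tendsto (fun n => Q n ω) atTop (𝓝 a) := by
  have h1 : ∀ q : ℕ, ∀ᵐ ω ∂P, ∀ᶠ n in atTop, |Q n ω - e n| < 1 / ((q : ℝ) + 1) := fun q => by
    set ε : ℝ := 1 / ((q : ℝ) + 1)
    have hε : 0 < ε := by positivity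
    obtain ⟨n₀, hn₀⟩ := eventually_atTop.1 (hQ ε hε)
    -- The clause `n₀ ≤ n` empties the events for which no tail bound is available.
    have hsum : ∑' n, P {ω | n₀ ≤ n ∧ ε ≤ |Q n ω - e n|} ≠ ⊤ := by
      have hle : ∀ n, P {ω | n₀ ≤ n ∧ ε ≤ |Q n ω - e n|} ≤ ENNReal.ofReal |f ε n| := fun n => by
        by_cases hn : n₀ ≤ n
        · simp only [hn, true_and]
          rw [← ofReal_measureReal]
          exact ENNReal.ofReal_le_ofReal ((hn₀ n hn).trans (le_abs_self _))
        · simp [hn]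
      exact ne_top_of_le_ne_top (hf ε hε).abs.tsum_ofReal_ne_top (ENNReal.tsum_le_tsum hle)
    filter_upwards [ae_eventually_notMem hsum] with ω hω
    filter_upwards [hω, eventually_ge_atTop n₀] with n hn hn'
    by_contra hcon
    exact hn ⟨hn', not_lt.1 hcon⟩
  filter_upwards [ae_all_iff.2 h1] with ω hω
  have h2 : Tendsto (fun n => Q n ω - e n) atTop (𝓝 0) := by
    refine Metric.tendsto_atTop'.2 fun δ hδ => ?_
    obtain ⟨q, hq⟩ := exists_nat_one_div_lt hδ
    obtain ⟨n₀, hn₀⟩ := eventually_atTop.1 (hω q)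
    exact ⟨n₀, fun n hn => by
      rw [Real.dist_eq, sub_zero]; exact (hn₀ n hn.le).trans hq⟩
  simpa using h2.add he

end

/-! ### Almost sure convergence and the three variance regimes -/

/-- Growth of the shell sums in the divergent regime. -/
lemma exists_one_add_sum_rpow_le {p : ℝ} (hp : 0 < p) (R : ℕ) :
    ∃ C, 0 < C ∧ ∀ n : ℕ, 0 < n →
      1 + ∑ r ∈ Finset.range (R * n), ((r : ℝ) + 1) ^ (p - 1) ≤ C * (n : ℝ) ^ p := by
  obtain ⟨C, hC, h⟩ := sum_rpow_sub_one_le hp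
  refine ⟨1 + C * (R : ℝ) ^ p, by positivity, fun n hn => ?_⟩
  have h1 : (1 : ℝ) ≤ (n : ℝ) ^ p := Real.one_le_rpow (by exact_mod_cast hn) hp.le
  have h2 := h (R * n)
  push_cast at h2
  rw [Real.mul_rpow (by positivity) (by positivity)] at h2
  linarith

theorem ae_tendsto_and_exists_variance_le {d : ℕ} {S : Type*} [MeasurableSpace S] {P : Measure S}
    [IsProbabilityMeasure P] {Q : ℕ → S → ℝ} {e : ℕ → ℝ} {a s : ℝ} (hd : 1 ≤ d) (hs : s < 0)
    (he : Tendsto e atTop (𝓝 a)) {R : ℕ} (hR : 0 < R) {C : ℝ} (hC : 0 < C)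
    (hQ : ∀ᶠ n : ℕ in atTop,
      ∃ (ι : Type) (_ : Fintype ι) (X : ι → S → ℝ), HasGaussianLaw (fun ω => (X · ω)) P ∧
        (∀ i, ∫ ω, X i ω ∂P = 0) ∧ (∀ ω, Q n ω = ∑ i, X i ω ^ 2) ∧
        ∑ i, cov[X i, X i; P] = e n ∧
        ∑ i, ∑ j, cov[X i, X j; P] ^ 2 ≤ C * (n : ℝ) ^ (-(d : ℝ)) *
          (1 + ∑ r ∈ Finset.range (R * n), ((r : ℝ) + 1) ^ ((d : ℝ) - 1 + s))) :
    (∀ᵐ ω ∂P, Tendsto (fun n => Q n ω) atTop (𝓝 a)) ∧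
    ∃ c : ℝ, 0 < c ∧ ∀ᶠ n : ℕ in atTop, MemLp (Q n) 2 P ∧
      (-(d : ℝ) < s → Var[Q n; P] ≤ c * (n : ℝ) ^ s) ∧
      (s = -(d : ℝ) → Var[Q n; P] ≤ c * (n : ℝ) ^ (-(d : ℝ)) * Real.log n) ∧
      (s < -(d : ℝ) → Var[Q n; P] ≤ c * (n : ℝ) ^ (-(d : ℝ))) := by
  have hd' : (1 : ℝ) ≤ d := by exact_mod_cast hd
  constructor
  -- With `b ≤ -s` the shell exponent is at most `d - b - 1`, and `b ≤ 1/2` keeps `d - b` positive.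
  -- The concentration scale is then of order `n^(-b/2)`, so tails are of order `exp (-c n^(b/2))`,
  -- which is summable for every `b > 0`.
  · set b := min (-s) (1 / 2) with hb
    have hb0 : 0 < b := lt_min (by linarith) (by norm_num)
    have hb1 : b ≤ 1 / 2 := min_le_right _ _
    have hbs : b ≤ -s := min_le_left _ _
    obtain ⟨C₁, hC₁, hsum⟩ := exists_one_add_sum_rpow_le (show 0 < (d : ℝ) - b by linarith) R
    set K := √(C * C₁)
    have hK : 0 < K := Real.sqrt_pos.2 (by positivity)
    have hK2 : K ^ 2 = C * C₁ := Real.sq_sqrt (by positivity)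
    refine ae_tendsto_of_summable_tail he
      (f := fun ε n => 2 * Real.exp (1 / 8) * Real.exp (-(ε / (4 * K)) * (n : ℝ) ^ (b / 2)))
      (fun ε hε => (summable_exp_neg_mul_rpow (by positivity) (by linarith)).mul_left _)
      fun ε hε => ?_
    filter_upwards [hQ, eventually_gt_atTop 0] with n hn hn0
    obtain ⟨ι, _, X, hX, h0, hQX, htr, hcov⟩ := hn
    have hn' : (0 : ℝ) < n := by exact_mod_cast hn0
    have hle : ∑ r ∈ Finset.range (R * n), ((r : ℝ) + 1) ^ ((d : ℝ) - 1 + s) ≤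
        ∑ r ∈ Finset.range (R * n), ((r : ℝ) + 1) ^ ((d : ℝ) - b - 1) := by
      refine Finset.sum_le_sum fun r _ => Real.rpow_le_rpow_of_exponent_le ?_ (by linarith)
      have : (0 : ℝ) ≤ r := by positivity
      linarith
    have hT := (add_le_add_right hle 1).trans (hsum n hn0)
    have hΛ : ∑ i, ∑ j, cov[X i, X j; P] ^ 2 ≤ (K * (n : ℝ) ^ (-(b / 2))) ^ 2 := by
      calc _ ≤ C * (n : ℝ) ^ (-(d : ℝ)) * (C₁ * (n : ℝ) ^ ((d : ℝ) - b)) :=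
            hcov.trans (by gcongr)
        _ = (C * C₁) * ((n : ℝ) ^ (-(d : ℝ)) * (n : ℝ) ^ ((d : ℝ) - b)) := by ring
        _ = (C * C₁) * ((n : ℝ) ^ (-(b / 2))) ^ 2 := by
            rw [← Real.rpow_add hn', ← Real.rpow_natCast, ← Real.rpow_mul hn'.le]
            congr 2
            push_cast
            ring
        _ = _ := by rw [mul_pow, hK2]
    have := measureReal_abs_sum_sq_sub_ge_le hX h0 (by positivity) hΛ ε
    simp_rw [hQX, ← htr]
    refine this.trans (le_of_eq ?_)
    rw [mul_assoc, ← Real.exp_add, Real.rpow_neg hn'.le]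
    congr 2
    have : 0 < (n : ℝ) ^ (b / 2) := by positivity
    field_simp
    ring
  · set κ := Var[fun x => x ^ 2; gaussianReal 0 1]
    have hκ : 0 ≤ κ := variance_nonneg _ _
    have hV : ∀ᶠ n : ℕ in atTop, MemLp (Q n) 2 P ∧ Var[Q n; P] ≤ κ * (C * (n : ℝ) ^ (-(d : ℝ)) *
        (1 + ∑ r ∈ Finset.range (R * n), ((r : ℝ) + 1) ^ ((d : ℝ) - 1 + s))) := by
      filter_upwards [hQ] with n hn
      obtain ⟨ι, _, X, hX, h0, hQX, -, hcov⟩ := hn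
      obtain ⟨h1, h2⟩ := memLp_sum_sq_and_variance hX h0
      rw [show Q n = fun ω => ∑ i, X i ω ^ 2 from funext hQX]
      exact ⟨h1, h2 ▸ mul_le_mul_of_nonneg_left hcov hκ⟩
    rcases lt_trichotomy s (-(d : ℝ)) with hsd | hsd | hsd
    · obtain ⟨C₁, hC₁, hsum⟩ := sum_rpow_le_of_lt (show (d : ℝ) - 1 + s < -1 by linarith)
      -- Only `κ ≥ 0` is used, so the added `1` secures a positive constant.
      refine ⟨κ * (C * (1 + C₁)) + 1, by positivity, ?_⟩
      filter_upwards [hV, eventually_gt_atTop 0] with n ⟨hm, hn⟩ hn0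
      refine ⟨hm, fun h => absurd h hsd.le.not_gt, fun h => absurd h hsd.ne, fun _ => ?_⟩
      have hx : 0 < (n : ℝ) ^ (-(d : ℝ)) := by positivity
      calc _ ≤ _ := hn
        _ ≤ κ * (C * (n : ℝ) ^ (-(d : ℝ)) * (1 + C₁)) := by gcongr; exact hsum _
        _ = κ * (C * (1 + C₁)) * (n : ℝ) ^ (-(d : ℝ)) := by ring
        _ ≤ _ := by gcongr; linarith
    · have hlogR : 0 ≤ Real.log R := Real.log_nonneg (by exact_mod_cast hR)
      refine ⟨κ * (C * (3 + Real.log R)) + 1, by positivity, ?_⟩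
      filter_upwards [hV, eventually_gt_atTop 0,
        (Real.tendsto_log_atTop.comp tendsto_natCast_atTop_atTop).eventually_ge_atTop 1]
        with n ⟨hm, hn⟩ hn0 hlog
      refine ⟨hm, fun h => absurd hsd h.ne', fun _ => ?_, fun h => absurd hsd h.ne⟩
      simp only [Function.comp_apply] at hlog
      have hR' : (R : ℝ) ≠ 0 := by positivity
      have hn' : (n : ℝ) ≠ 0 := by positivity
      have h1 := sum_rpow_neg_one_le (R * n)
      push_cast at h1
      rw [Real.log_mul hR' hn'] at h1
      rw [show (d : ℝ) - 1 + s = -1 by linarith] at hn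
      have hx : 0 < (n : ℝ) ^ (-(d : ℝ)) := by positivity
      -- The sum is at most `1 + log R + log n`; since `log n ≥ 1`, the constants are absorbed into
      -- the factor `3 + log R`.
      have h2 : 1 + ∑ r ∈ Finset.range (R * n), ((r : ℝ) + 1) ^ (-1 : ℝ) ≤
          (3 + Real.log R) * Real.log n := by nlinarith
      calc _ ≤ _ := hn
        _ ≤ κ * (C * (n : ℝ) ^ (-(d : ℝ)) * ((3 + Real.log R) * Real.log n)) := by gcongr
        _ = κ * (C * (3 + Real.log R)) * (n : ℝ) ^ (-(d : ℝ)) * Real.log n := by ring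
        _ ≤ _ := by gcongr; linarith
    · obtain ⟨C₁, hC₁, hsum⟩ := exists_one_add_sum_rpow_le (show 0 < (d : ℝ) + s by linarith) R
      refine ⟨κ * (C * C₁) + 1, by positivity, ?_⟩
      filter_upwards [hV, eventually_gt_atTop 0] with n ⟨hm, hn⟩ hn0
      refine ⟨hm, fun _ => ?_, fun h => absurd h hsd.ne', fun h => absurd h hsd.le.not_gt⟩
      have hn' : (0 : ℝ) < n := by exact_mod_cast hn0
      have h1 := hsum n hn0
      rw [show (d : ℝ) + s - 1 = d - 1 + s by ring] at h1
      calc _ ≤ _ := hn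
        _ ≤ κ * (C * (n : ℝ) ^ (-(d : ℝ)) * (C₁ * (n : ℝ) ^ ((d : ℝ) + s))) := by gcongr
        _ = κ * (C * C₁) * ((n : ℝ) ^ (-(d : ℝ)) * (n : ℝ) ^ ((d : ℝ) + s)) := by ring
        _ = κ * (C * C₁) * (n : ℝ) ^ s := by
            rw [← Real.rpow_add hn', neg_add_cancel_left]
        _ ≤ _ := by gcongr; linarith

end Matern

end

theorem theorem1 {d : ℕ} {S : Type*} [MeasurableSpace S] (P : Measure S) [IsProbabilityMeasure P]
    (σ α ν : ℝ) (M : Matrix (Fin d) (Fin d) ℝ)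
    (D : Set (EuclideanSpace ℝ (Fin d)))
    (Y : EuclideanSpace ℝ (Fin d) → S → ℝ)
    (hY : Matern.IsField P σ α ν M D Y)
    (Ω : Set (EuclideanSpace ℝ (Fin d)))
    (hΩ_open : IsOpen Ω) (hΩ_bdd : Bornology.IsBounded Ω) (hΩ_ne : Ω.Nonempty)
    (h : EuclideanSpace ℝ (Fin d)) (hh : h ≠ 0)
    (m : ℕ) (hm : ν < m)
    (hD : ∀ᶠ n : ℕ in atTop, ∀ j ∈ Matern.grid Ω n, ∀ k ≤ m,
      j + ((k : ℝ) / (n : ℝ)) • h ∈ D) :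
    (∀ᵐ ω ∂P, Tendsto (fun n : ℕ => Matern.quadVar ν h m Ω Y n ω) atTop
      (𝓝 (Matern.limitCoeff σ α ν M h m))) ∧
    ∃ c : ℝ, 0 < c ∧ ∀ᶠ n : ℕ in atTop,
      MemLp (Matern.quadVar ν h m Ω Y n) 2 P ∧
      (-(d : ℝ) < 4 * (ν - m) →
        Var[Matern.quadVar ν h m Ω Y n; P] ≤ c * (n : ℝ) ^ (4 * (ν - m))) ∧
      (4 * (ν - m) = -(d : ℝ) →
        Var[Matern.quadVar ν h m Ω Y n; P] ≤ c * (n : ℝ) ^ (-(d : ℝ)) * Real.log n) ∧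
      (4 * (ν - m) < -(d : ℝ) →
        Var[Matern.quadVar ν h m Ω Y n; P] ≤ c * (n : ℝ) ^ (-(d : ℝ))) := by
  have hd : 1 ≤ d := by
    rcases d with _ | d
    · exact absurd (Subsingleton.elim h 0) hh
    · omega
  obtain ⟨R, C, hR, hC, hQ⟩ :=
    Matern.exists_eventually_quadVar_eq_sum_sq hY hΩ_open hΩ_bdd hΩ_ne hh hm hD
  exact Matern.ae_tendsto_and_exists_variance_le hd (by linarith)
    (Matern.tendsto_limitCoeff hY.alpha_pos hY.nu_pos hY.det_eq_one hh hm) hR hC hQ
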